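/- **Definitions.** Fix finite sets of node labels and of (terminal) edge labels, a type (a finite sequence of node labels) for each edge label, a domain $\Omega(\ell)$ for each node label, and a function $F(t):\Omega(\ell_1)\times\dots\times\Omega(\ell_k)\to\mathbb R_{\ge 0}$ for each terminal label $t$ of type $\ell_1\cdots\ell_k$. A *factor graph* is a finite hypergraph with correspondingly labelled nodes and edges; the *weight* of an assignment of values to its nodes is the product of all its factors. A *factor graph grammar* (FGG) is a hyperedge replacement grammar that generates factor graphs: finitely many nonterminals, each with a type (the start symbol has the empty type), and finitely many rules $X\to R$, where $R$ is a hypergraph fragment with terminal and nonterminal edges and a sequence of external nodes of type $\mathrm{type}(X)$. A *derivation tree* chooses a rule for the start symbol and, recursively, for each nonterminal edge; its *derived graph* is obtained by replacing each nonterminal edge with the derived graph of its subtree, identifying $j$-th endpoint and $j$-th external node. The *sum–product* of an FGG is the sum, over all derivations and all assignments of the derived graph, of the weights. Two rules are *conjoinable* if they have the same nodes, node labels, external nodes and nonterminal edges with the same endpoints, and corresponding nonterminals have equal types; their *conjunction* pairs the nonterminal labels and contains the terminal edges of both. The *conjunction* $G_1\sqcap G_2$ has as rules the conjunctions of all conjoinable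 pairs of rules, and as start symbol the pair of start symbols. An FGG *generates exactly one graph* $H$ if it has exactly one derivation, whose derived graph is $H$ up to isomorphism. A *plated factor graph* (PFG) is a factor graph $H$ with a finite set $B$ of plates and a set $P(\cdot)\subseteq B$ for each node and edge, with $P(v)\subseteq P(e)$ if $v$ is an endpoint of $e$. Its *unrolling* by $M:B\to\mathbb N$ has a copy of each node or edge $z$ for each element of $\prod_{b\in P(z)}\{1,\dots,M(b)\}$; a copy of $e$ is attached to the copies of its endpoints with the restricted indices. The sum–product algorithm of Obermeyer et al. repeats the following while a factor remains: choose a plate set $L$ of maximal cardinality among the plate sets of the factors; for each connected component $C$ of the subgraph of nodes and factors with plate set exactly $L$, let $V_f$ be the variables outside $C$ incident to factors in $C$, and $L'=\bigcup_{v\in V_f}P(v)$; if $V_f\ne\emptyset$ and $L'=L$, fail; otherwise remove $C$ and, if $V_f\neq\emptyset$, add a new factor with endpoints $V_f$ and plate set $L'$. It *succeeds* on $H$ if some run does not fail. A *dynamic graphical model* (DGM) consists of factor graphs $H_1,H_2,H_3$ with node sets $V_1,V_2,V_3$ and sets $E_{12}\subseteq V_1\times V_2$, $E_{22}\subseteq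 V_2\times V_2$, $E_{23}\subseteq V_2\times V_3$ of binary factors. For $n\ge2$, its *unrolling* by $n$ consists of $H_1$, $n$ copies of $H_2$, and $H_3$, with a factor from $u$ to $(v,1)$ for $(u,v)\in E_{12}$, from $(u,i-1)$ to $(v,i)$ for $(u,v)\in E_{22}$ and $1<i\le n$, and from $(u,n)$ to $v$ for $(u,v)\in E_{23}$. Let $\mathrm{scope}(v)$ be the set of variables mentioned in $v$ or a descendant of $v$. A *case–factor diagram* (CFD) model $(D,\Psi)$ is a finite rooted DAG $D$ with root $r$, whose nodes are: $\mathsf{case}(x)$ with children $v_1,v_2$ and $x\notin\mathrm{scope}(v_1)\cup\mathrm{scope}(v_2)$; $\mathsf{factor}$ with children $v_1,v_2$ of disjoint scopes; $\mathsf{unit}$; or $\mathsf{empty}$; together with $\Psi:\mathrm{scope}(r)\to\mathbb R_{\ge0}$. For $\xi:\mathrm{scope}(r)\to\{0,1\}$, define $q(v,\xi)$ and $Z(v)$: for $\mathsf{case}(x)$, $q(v,\xi)=e^{-\Psi(x)}q(v_1,\xi)$ if $\xi(x)=1$ and $q(v_2,\xi)$ if $\xi(x)=0$, and $Z(v)=e^{-\Psi(x)}Z(v_1)+Z(v_2)$;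 for $\mathsf{factor}$, $q$ and $Z$ are the products of those of the children; for $\mathsf{unit}$ both are $1$, for $\mathsf{empty}$ both are $0$. Put $q(\xi)=q(r,\xi)$; the sum–product is $Z(r)$. A *valid sum–product network* (SPN) is a finite rooted DAG whose nodes are: $\mathsf{sum}(\lambda_1,\lambda_2)$ with $\lambda_i\ge0$ and children of equal scope; $\mathsf{product}$ with two children such that no variable appears in one and negated in the other; or a literal $x$ or $\bar x$. For $\xi:\mathrm{scope}(r)\to\{0,1\}$, let $q(v,\xi)=\lambda_1q(v_1,\xi)+\lambda_2q(v_2,\xi)$, $q(v_1,\xi)\,q(v_2,\xi)$, $\xi(x)$, $1-\xi(x)$, respectively; $q(\xi)=q(r,\xi)$, and the sum–product is $\sum_\xi q(\xi)$. **Theorem.** All of the following can be converted into an equivalent FGG. 1. *Plated factor graphs.* If the sum–product algorithm of Obermeyer et al. succeeds on the PFG $H$, then there is an FGG $G$ such that for every $M:B\to\mathbb N$ there is an FGG $G_M$ without factors such that $G\sqcap G_M$ generates exactly one graph, the unrolling of $H$ by $M$. 2. *Dynamic graphical models.* For every DGM $D$ there is an FGG $G$ such that for every $n\ge2$ there is an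 FGG $G_n$ without factors such that $G\sqcap G_n$ generates exactly one graph, the unrolling of $D$ by $n$. 3. *Case–factor diagrams.* For every CFD model $(D,\Psi)$ there is an FGG $G$ with the same sum–product, such that for every assignment $\xi$ there is an FGG $G_\xi$, whose only factors are indicators $[x=\xi(x)]$ on single nodes labelled $x$, such that the sum–product of $G\sqcap G_\xi$ equals $q(\xi)$. 4. *Valid sum–product networks.* For every valid SPN $D$ there is an FGG $G$ with the same sum–product, such that for every assignment $\xi$ there is an FGG $G_\xi$, whose only factors are indicators $[x=\xi(x)]$ on single nodes labelled $x$, such that the sum–product of $G\sqcap G_\xi$ equals $q(\xi)$. In 3 and 4, the node labels are the variables, each with domain $\{0,1\}$, and the conversion is linear: $G$ and every $G_\xi$ have at most twice as many rules as $D$ has nodes, and each right-hand side has at most one node, two nonterminal edges and two factors. -/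

import Mathlib

universe u

open scoped NNReal ENNReal

/-! ## Hypergraphs and factor graphs -/

/-- The global data: a finite set of node labels, a finite set of terminal edge labels with their
types, the domain of values of each node label, and the function attached to each terminal
edge label. -/
structure Signature where
  NodeLabel : Type
  Term : Type
  finite_nodeLabel : Finite NodeLabel
  finite_term : Finite Term
  type : Term → List NodeLabel
  Ω : NodeLabel → Type u
  F : (t : Term) → ((i : Fin (type t).length) → Ω ((type t).get i)) → ℝ≥0

/-- A finite hypergraph whose edges carry terminal labels. Read with `S.Ω` and `S.F`, it is a
factor graph. The map `att e` is the sequence of endpoints of `e`. -/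
structure FactorGraph (S : Signature.{u}) where
  V : Type
  E : Type
  finite_V : Finite V
  finite_E : Finite E
  labV : V → S.NodeLabel
  labE : E → S.Term
  att : (e : E) → Fin (S.type (labE e)).length → V
  att_lab : ∀ e i, labV (att e i) = (S.type (labE e)).get i

namespace FactorGraph

variable {S : Signature.{u}}

/-- Isomorphisms of labelled hypergraphs. -/
structure Iso (H K : FactorGraph S) where
  onV : H.V ≃ K.V
  onE : H.E ≃ K.E
  labV_eq : ∀ v, K.labV (onV v) = H.labV v
  labE_eq : ∀ e, K.labE (onE e) = H.labE e
  att_eq : ∀ e (i : ℕ) (h : i < (S.type (H.labE e)).length)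
    (h' : i < (S.type (K.labE (onE e))).length), K.att (onE e) ⟨i, h'⟩ = onV (H.att e ⟨i, h⟩)

/-- Assignments of values to the nodes. -/
abbrev Assignment (H : FactorGraph S) : Type u := (v : H.V) → S.Ω (H.labV v)

/-- The weight of an assignment: the product of all factors. -/
noncomputable def weight (H : FactorGraph S) (ξ : H.Assignment) : ℝ≥0 :=
  ∏ᶠ e : H.E, S.F (H.labE e) fun i => cast (congrArg S.Ω (H.att_lab e i)) (ξ (H.att e i))

end FactorGraph

/-- A hypergraph fragment without nonterminal edges, whose sequence of external nodes has
labels `ℓ`. -/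
structure Fragment (S : Signature.{u}) (ℓ : List S.NodeLabel) extends FactorGraph S where
  ext : Fin ℓ.length → V
  ext_lab : ∀ j, labV (ext j) = ℓ.get j

/-! ## Factor graph grammars -/

/-- A hypergraph fragment that may contain nonterminal edges, used as a right-hand side for a
left-hand side of type `ℓ`. Nodes and nonterminal edges are natural numbers, so that they can be
compared between rules of different grammars. Nonterminal and terminal edges are kept in two
separate (hence disjoint) collections. -/
structure RHS (S : Signature.{u}) (N : Type) (ntype : N → List S.NodeLabel)
    (ℓ : List S.NodeLabel) where
  nodes : Finset ℕ
  labV : nodes → S.NodeLabel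
  nedges : Finset ℕ
  nlab : nedges → N
  natt : (e : nedges) → Fin (ntype (nlab e)).length → nodes
  natt_lab : ∀ e i, labV (natt e i) = (ntype (nlab e)).get i
  TEdge : Type
  finite_TEdge : Finite TEdge
  tlab : TEdge → S.Term
  tatt : (e : TEdge) → Fin (S.type (tlab e)).length → nodes
  tatt_lab : ∀ e i, labV (tatt e i) = (S.type (tlab e)).get i
  ext : Fin ℓ.length → nodes
  ext_lab : ∀ j, labV (ext j) = ℓ.get j

/-- A factor graph grammar over the signature `S`. -/
structure FGG (S : Signature.{u}) where
  N : Type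
  finite_N : Finite N
  ntype : N → List S.NodeLabel
  Rule : Type
  finite_Rule : Finite Rule
  lhs : Rule → N
  rhs : (r : Rule) → RHS S N ntype (ntype (lhs r))
  start : N
  start_type : ntype start = []

/-! ### Replacement and derived graphs -/

section Glue

variable {S : Signature.{u}} {N : Type} {ntype : N → List S.NodeLabel} {ℓ : List S.NodeLabel}

/-- The identification made when every nonterminal edge `e` of `R` is replaced with `H e`: the
`j`-th endpoint of `e` and the `j`-th external node of `H e` become the same node. -/
inductive GlueRel (R : RHS S N ntype ℓ) (H : (e : R.nedges) → Fragment S (ntype (R.nlab e))) :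
    (R.nodes ⊕ (Σ e : R.nedges, (H e).V)) → (R.nodes ⊕ (Σ e : R.nedges, (H e).V)) → Prop
  | mk (e : R.nedges) (j : Fin (ntype (R.nlab e)).length) :
      GlueRel R H (Sum.inl (R.natt e j)) (Sum.inr ⟨e, (H e).ext j⟩)

/-- Replace every nonterminal edge `e` of `R` with the fragment `H e`. -/
def glue (R : RHS S N ntype ℓ) (H : (e : R.nedges) → Fragment S (ntype (R.nlab e))) :
    Fragment S ℓ where
  V := Quot (GlueRel R H)
  E := R.TEdge ⊕ (Σ e : R.nedges, (H e).E)
  finite_V := by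
    have : ∀ e, Finite (H e).V := fun e => (H e).finite_V
    infer_instance
  finite_E := by
    have : ∀ e, Finite (H e).E := fun e => (H e).finite_E
    have := R.finite_TEdge
    infer_instance
  labV := Quot.lift (Sum.elim R.labV fun p => (H p.1).labV p.2) (by
    rintro _ _ ⟨e, j⟩
    simp only [Sum.elim_inl, Sum.elim_inr]
    rw [R.natt_lab e j, (H e).ext_lab j])
  labE := Sum.elim R.tlab fun p => (H p.1).labE p.2
  att := fun e => match e with
    | Sum.inl e => fun i => Quot.mk _ (Sum.inl (R.tatt e i))
    | Sum.inr p => fun i => Quot.mk _ (Sum.inr ⟨p.1, (H p.1).att p.2 i⟩)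
  att_lab := by
    rintro (e | p) i
    · exact R.tatt_lab e i
    · exact (H p.1).att_lab p.2 i
  ext := fun j => Quot.mk _ (Sum.inl (R.ext j))
  ext_lab := fun j => R.ext_lab j

end Glue

namespace FGG

variable {S : Signature.{u}}

/-- `G.Derivation X` is the set of `X`-type derivation trees of `G`. -/
inductive Derivation (G : FGG S) : G.N → Type
  | mk (r : G.Rule) (children : (e : (G.rhs r).nedges) → Derivation G ((G.rhs r).nlab e)) :
      Derivation G (G.lhs r)

/-- The derived graph of a derivation. -/
def Derivation.derived {G : FGG S} : {X : G.N} → G.Derivation X → Fragment S (G.ntype X)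
  | _, .mk r children => glue (G.rhs r) fun e => (children e).derived

/-- The factor graph generated by a derivation of the start symbol. -/
def Derivation.graph {G : FGG S} (D : G.Derivation G.start) : FactorGraph S :=
  D.derived.toFactorGraph

/-- The sum–product of a grammar: the sum, over all derivations and all assignments of the derived
graph, of the weights. -/
noncomputable def sumProduct (G : FGG S) : ℝ≥0∞ :=
  ∑' D : G.Derivation G.start, ∑' ξ : D.graph.Assignment, (D.graph.weight ξ : ℝ≥0∞)

/-- `G` has exactly one derivation, and its derived graph is `H` (up to isomorphism). -/
def GeneratesExactly (G : FGG S) (H : FactorGraph S) : Prop :=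
  ∃ D : G.Derivation G.start, (∀ D' : G.Derivation G.start, D' = D) ∧
    Nonempty (FactorGraph.Iso D.graph H)

/-- No right-hand side of `G` contains a factor. -/
def FactorFree (G : FGG S) : Prop :=
  ∀ r, IsEmpty (G.rhs r).TEdge

/-- `G` has at most `2 * n` rules, and each right-hand side has at most one node, at most two
nonterminal edges and at most two factors. -/
def LinearSize (G : FGG S) (n : ℕ) : Prop :=
  Nat.card G.Rule ≤ 2 * n ∧ ∀ r, (G.rhs r).nodes.card ≤ 1 ∧ (G.rhs r).nedges.card ≤ 2 ∧
    Nat.card (G.rhs r).TEdge ≤ 2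

/-! ### Conjunction -/

/-- Two rules are conjoinable if they have the same nodes, node labels, nonterminal edges with the
same endpoints, and external nodes, and their left-hand sides and the labels of their nonterminal
edges have the same types. -/
structure Conjoinable (G₁ G₂ : FGG S) (r₁ : G₁.Rule) (r₂ : G₂.Rule) : Prop where
  type_eq : G₁.ntype (G₁.lhs r₁) = G₂.ntype (G₂.lhs r₂)
  nodes_eq : (G₁.rhs r₁).nodes = (G₂.rhs r₂).nodes
  labV_eq : ∀ v h₁ h₂, (G₁.rhs r₁).labV ⟨v, h₁⟩ = (G₂.rhs r₂).labV ⟨v, h₂⟩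
  nedges_eq : (G₁.rhs r₁).nedges = (G₂.rhs r₂).nedges
  ntype_eq : ∀ e h₁ h₂,
    G₁.ntype ((G₁.rhs r₁).nlab ⟨e, h₁⟩) = G₂.ntype ((G₂.rhs r₂).nlab ⟨e, h₂⟩)
  natt_eq : ∀ e h₁ h₂ i k₁ k₂,
    ((G₁.rhs r₁).natt ⟨e, h₁⟩ ⟨i, k₁⟩ : ℕ) = (G₂.rhs r₂).natt ⟨e, h₂⟩ ⟨i, k₂⟩
  ext_eq : ∀ i k₁ k₂, ((G₁.rhs r₁).ext ⟨i, k₁⟩ : ℕ) = (G₂.rhs r₂).ext ⟨i, k₂⟩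

/-- The conjunction of two grammars over the same signature. Its nonterminals are the pairs of
nonterminals of equal type, and its rules are the conjunctions of all conjoinable pairs of rules. -/
def conj (G₁ G₂ : FGG S) : FGG S where
  N := {p : G₁.N × G₂.N // G₁.ntype p.1 = G₂.ntype p.2}
  finite_N := by
    have := G₁.finite_N
    have := G₂.finite_N
    infer_instance
  ntype := fun p => G₁.ntype p.1.1
  Rule := {p : G₁.Rule × G₂.Rule // Conjoinable G₁ G₂ p.1 p.2}
  finite_Rule := by
    have := G₁.finite_Rule
    have := G₂.finite_Rule
    infer_instance
  lhs := fun p => ⟨(G₁.lhs p.1.1, G₂.lhs p.1.2), p.2.type_eq⟩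
  rhs := fun p =>
    { nodes := (G₁.rhs p.1.1).nodes
      labV := (G₁.rhs p.1.1).labV
      nedges := (G₁.rhs p.1.1).nedges
      nlab := fun e =>
        ⟨((G₁.rhs p.1.1).nlab e, (G₂.rhs p.1.2).nlab ⟨e.1, p.2.nedges_eq ▸ e.2⟩),
          p.2.ntype_eq e.1 e.2 _⟩
      natt := (G₁.rhs p.1.1).natt
      natt_lab := (G₁.rhs p.1.1).natt_lab
      TEdge := (G₁.rhs p.1.1).TEdge ⊕ (G₂.rhs p.1.2).TEdge
      finite_TEdge := by
        have := (G₁.rhs p.1.1).finite_TEdge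
        have := (G₂.rhs p.1.2).finite_TEdge
        infer_instance
      tlab := Sum.elim (G₁.rhs p.1.1).tlab (G₂.rhs p.1.2).tlab
      tatt := fun e => match e with
        | Sum.inl e => (G₁.rhs p.1.1).tatt e
        | Sum.inr e => fun i =>
            ⟨((G₂.rhs p.1.2).tatt e i).1, p.2.nodes_eq.symm ▸ ((G₂.rhs p.1.2).tatt e i).2⟩
      tatt_lab := by
        rintro (e | e) i
        · exact (G₁.rhs p.1.1).tatt_lab e i
        · exact (p.2.labV_eq _ _ _).trans ((G₂.rhs p.1.2).tatt_lab e i)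
      ext := (G₁.rhs p.1.1).ext
      ext_lab := (G₁.rhs p.1.1).ext_lab }
  start := ⟨(G₁.start, G₂.start), by rw [G₁.start_type, G₂.start_type]⟩
  start_type := G₁.start_type

end FGG

/-! ## Plated factor graphs -/

/-- A plated factor graph with set of plates `B`: a factor graph in which every node `v` and every
edge `e` lies in a set of plates, and every plate of an endpoint of `e` is a plate of `e`. -/
structure PFG (S : Signature.{u}) (B : Type) extends FactorGraph S where
  plateV : V → Set B
  plateE : E → Set B
  plate_sub : ∀ e i, plateV (att e i) ⊆ plateE e

/-- The unrolling of `H` by `M`: one copy of a node or edge for every choice of an instance of each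
plate that it lies in. -/
def PFG.unroll {S : Signature.{u}} {B : Type} [Finite B] (H : PFG S B) (M : B → ℕ) :
    FactorGraph S where
  V := Σ v : H.V, ((b : H.plateV v) → Fin (M b))
  E := Σ e : H.E, ((b : H.plateE e) → Fin (M b))
  finite_V := by
    have := H.finite_V
    infer_instance
  finite_E := by
    have := H.finite_E
    infer_instance
  labV := fun p => H.labV p.1
  labE := fun p => H.labE p.1
  att := fun p i => ⟨H.att p.1 i, fun b => p.2 ⟨b.1, H.plate_sub p.1 i b.2⟩⟩
  att_lab := fun p i => H.att_lab p.1 i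

/-- The part of a plated factor graph that the control flow of tensor variable elimination depends
on: variables, factors, incidence and plate sets. -/
structure PlatedGraph (B : Type) where
  V : Type
  E : Type
  Inc : V → E → Prop
  plateV : V → Set B
  plateE : E → Set B

namespace PlatedGraph

variable {B : Type}

/-- The bipartite graph of the variables and factors whose plate set is exactly `L`. -/
def leaf (H : PlatedGraph B) (L : Set B) :
    SimpleGraph ({v : H.V // H.plateV v = L} ⊕ {e : H.E // H.plateE e = L}) :=
  SimpleGraph.fromRel fun a b => ∃ v e, a = Sum.inl v ∧ b = Sum.inr e ∧ H.Inc v.1 e.1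

/-- The variables that are not in the component `c` but are incident to a factor in `c`. -/
def boundary (H : PlatedGraph B) (L : Set B) (c : (H.leaf L).ConnectedComponent) : Set H.V :=
  {v | (∀ h : H.plateV v = L, (H.leaf L).connectedComponentMk (Sum.inl ⟨v, h⟩) ≠ c) ∧
    ∃ e, ∃ h : H.plateE e = L,
      (H.leaf L).connectedComponentMk (Sum.inr ⟨e, h⟩) = c ∧ H.Inc v e}

/-- The union of the plate sets of the boundary of `c`. -/
def nextPlates (H : PlatedGraph B) (L : Set B) (c : (H.leaf L).ConnectedComponent) : Set B :=
  ⋃ v ∈ H.boundary L c, H.plateV v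

/-- Remove all variables and factors with plate set `L`. For each connected component of the
removed part that has a nonempty boundary, add a new factor that is incident to the boundary and
lies in the union of the plate sets of the boundary. (The result for a component with empty
boundary is a constant, which is set aside.) -/
def reduce (H : PlatedGraph B) (L : Set B) : PlatedGraph B where
  V := {v : H.V // H.plateV v ≠ L}
  E := {e : H.E // H.plateE e ≠ L} ⊕
    {c : (H.leaf L).ConnectedComponent // (H.boundary L c).Nonempty}
  Inc := fun v => Sum.elim (fun e => H.Inc v.1 e.1) fun c => v.1 ∈ H.boundary L c.1
  plateV := fun v => H.plateV v.1
  plateE := Sum.elim (fun e => H.plateE e.1) fun c => H.nextPlates L c.1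

/-- The tensor variable elimination algorithm has a run on `H` that succeeds. In each iteration, it
chooses a plate set `L` with a maximal number of plates among those of the remaining factors, and
fails if a connected component of the part with plate set `L` has a nonempty boundary whose plate
sets have union `L`. Otherwise, it replaces the components with new factors and continues, until no
factor remains. -/
inductive Succeeds : PlatedGraph B → Prop
  | done (H : PlatedGraph B) (h : IsEmpty H.E) : Succeeds H
  | step (H : PlatedGraph B) (e : H.E)
      (hmax : ∀ e', (H.plateE e').ncard ≤ (H.plateE e).ncard)
      (hok : ∀ c : (H.leaf (H.plateE e)).ConnectedComponent,
        (H.boundary (H.plateE e) c).Nonempty → H.nextPlates (H.plateE e) c ≠ H.plateE e)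
      (hrest : Succeeds (H.reduce (H.plateE e))) : Succeeds H

end PlatedGraph

/-- The variables, factors, incidences and plate sets of a plated factor graph. -/
def PFG.toPlatedGraph {S : Signature.{u}} {B : Type} (H : PFG S B) : PlatedGraph B where
  V := H.V
  E := H.E
  Inc := fun v e => ∃ i, H.att e i = v
  plateV := H.plateV
  plateE := H.plateE

/-! ## Dynamic graphical models -/

/-- A dynamic graphical model: three factor graphs, and three sets of binary factors between their
nodes. -/
structure DGM (S : Signature.{u}) where
  H₁ : FactorGraph S
  H₂ : FactorGraph S
  H₃ : FactorGraph S
  E₁₂ : Set (H₁.V × H₂.V)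
  E₂₂ : Set (H₂.V × H₂.V)
  E₂₃ : Set (H₂.V × H₃.V)
  lab₁₂ : E₁₂ → S.Term
  lab₂₂ : E₂₂ → S.Term
  lab₂₃ : E₂₃ → S.Term
  type₁₂ : ∀ p : E₁₂, S.type (lab₁₂ p) = [H₁.labV p.1.1, H₂.labV p.1.2]
  type₂₂ : ∀ p : E₂₂, S.type (lab₂₂ p) = [H₂.labV p.1.1, H₂.labV p.1.2]
  type₂₃ : ∀ p : E₂₃, S.type (lab₂₃ p) = [H₂.labV p.1.1, H₃.labV p.1.2]

/-- The endpoint sequence `a, b` of a binary edge. -/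
def pairAtt {V A : Type} (a b : V) (l : List A) : Fin l.length → V :=
  fun i => if (i : ℕ) = 0 then a else b

theorem pairAtt_lab {V A : Type} (lab : V → A) (a b : V) (l : List A) (h : l = [lab a, lab b])
    (i : Fin l.length) : lab (pairAtt a b l i) = l.get i := by
  subst h
  match i with
  | ⟨0, _⟩ => rfl
  | ⟨1, _⟩ => rfl

/-- The unrolling of length `n`: one copy of `H₁` and `H₃` and `n` copies of `H₂` (indexed from
`0`), with `E₁₂` from `H₁` to the first copy, `E₂₂` from each copy to the next one, and `E₂₃` from
the last copy to `H₃`. -/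
def DGM.unroll {S : Signature.{u}} (D : DGM S) (n : ℕ) (hn : 2 ≤ n) : FactorGraph S where
  V := D.H₁.V ⊕ (D.H₂.V × Fin n) ⊕ D.H₃.V
  E := (D.H₁.E ⊕ (D.H₂.E × Fin n) ⊕ D.H₃.E) ⊕ (D.E₁₂ ⊕ (D.E₂₂ × Fin (n - 1)) ⊕ D.E₂₃)
  finite_V := by
    have := D.H₁.finite_V
    have := D.H₂.finite_V
    have := D.H₃.finite_V
    infer_instance
  finite_E := by
    have := D.H₁.finite_V
    have := D.H₂.finite_V
    have := D.H₃.finite_V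
    have := D.H₁.finite_E
    have := D.H₂.finite_E
    have := D.H₃.finite_E
    infer_instance
  labV := Sum.elim D.H₁.labV (Sum.elim (fun p => D.H₂.labV p.1) D.H₃.labV)
  labE := Sum.elim (Sum.elim D.H₁.labE (Sum.elim (fun p => D.H₂.labE p.1) D.H₃.labE))
    (Sum.elim D.lab₁₂ (Sum.elim (fun p => D.lab₂₂ p.1) D.lab₂₃))
  att := fun e => match e with
    | .inl (.inl e) => fun k => .inl (D.H₁.att e k)
    | .inl (.inr (.inl (e, i))) => fun k => .inr (.inl (D.H₂.att e k, i))
    | .inl (.inr (.inr e)) => fun k => .inr (.inr (D.H₃.att e k))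
    | .inr (.inl p) => pairAtt (.inl p.1.1) (.inr (.inl (p.1.2, ⟨0, by omega⟩))) _
    | .inr (.inr (.inl (p, i))) =>
        pairAtt (.inr (.inl (p.1.1, ⟨(i : ℕ), by omega⟩))) (.inr (.inl (p.1.2, ⟨(i : ℕ) + 1, by omega⟩))) _
    | .inr (.inr (.inr p)) =>
        pairAtt (.inr (.inl (p.1.1, ⟨n - 1, by omega⟩))) (.inr (.inr p.1.2)) _
  att_lab := by
    rintro ((e | ⟨e, i⟩ | e) | (p | ⟨p, i⟩ | p)) k
    · exact D.H₁.att_lab e k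
    · exact D.H₂.att_lab e k
    · exact D.H₃.att_lab e k
    · exact pairAtt_lab (V := D.H₁.V ⊕ (D.H₂.V × Fin n) ⊕ D.H₃.V)
        (Sum.elim D.H₁.labV (Sum.elim (fun p => D.H₂.labV p.1) D.H₃.labV)) _ _ _ (D.type₁₂ p) k
    · exact pairAtt_lab (V := D.H₁.V ⊕ (D.H₂.V × Fin n) ⊕ D.H₃.V)
        (Sum.elim D.H₁.labV (Sum.elim (fun p => D.H₂.labV p.1) D.H₃.labV)) _ _ _ (D.type₂₂ p) k
    · exact pairAtt_lab (V := D.H₁.V ⊕ (D.H₂.V × Fin n) ⊕ D.H₃.V)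
        (Sum.elim D.H₁.labV (Sum.elim (fun p => D.H₂.labV p.1) D.H₃.labV)) _ _ _ (D.type₂₃ p) k

/-! ## Case–factor diagrams and sum–product networks -/

/-- The edge relation of a directed graph given by the lists of children of its nodes. -/
def IsChild {V : Type} (children : V → List V) (v w : V) : Prop := w ∈ children v

/-- `w` is `v` or a descendant of `v`. -/
def Reaches {V : Type} (children : V → List V) : V → V → Prop :=
  Relation.ReflTransGen (IsChild children)

/-- The directed graph is acyclic, and every node can be reached from the root. -/
structure IsRootedDAG {V : Type} (children : V → List V) (root : V) : Prop where
  acyclic : ∀ v, ¬ Relation.TransGen (IsChild children) v v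
  reach : ∀ v, Reaches children root v

theorem IsRootedDAG.wf {V : Type} [Finite V] {children : V → List V} {root : V}
    (h : IsRootedDAG children root) : WellFounded fun w v => IsChild children v w := by
  have : Std.Irrefl (Relation.TransGen fun w v => IsChild children v w) :=
    ⟨fun v hv => h.acyclic v (Relation.transGen_swap.mp hv)⟩
  exact (Finite.wellFounded_of_trans_of_irrefl
    (Relation.TransGen fun w v => IsChild children v w)).mono fun _ _ hvw =>
      Relation.TransGen.single (r := fun w v => IsChild children v w) hvw

/-- The kinds of nodes of a case–factor diagram over the variables `X`, with their children. -/
inductive CFDNode (X V : Type)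
  | case (x : X) (v₁ v₂ : V)
  | factor (v₁ v₂ : V)
  | unit
  | empty

/-- The children of a node. -/
def CFDNode.children {X V : Type} : CFDNode X V → List V
  | case _ v₁ v₂ => [v₁, v₂]
  | factor v₁ v₂ => [v₁, v₂]
  | unit => []
  | empty => []

/-- The variables mentioned in a node. -/
def CFDNode.vars {X V : Type} : CFDNode X V → Set X
  | case x _ _ => {x}
  | _ => ∅

/-- The variables mentioned in `v` or a descendant of `v`. -/
def cfdScope {X V : Type} (node : V → CFDNode X V) (v : V) : Set X :=
  {x | ∃ w, Reaches (fun u => (node u).children) v w ∧ x ∈ (node w).vars}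

/-- A case–factor diagram model whose set of variables is `X`. -/
structure CFD (X : Type) where
  V : Type
  finite_V : Finite V
  node : V → CFDNode X V
  root : V
  dag : IsRootedDAG (fun v => (node v).children) root
  case_scope : ∀ v x v₁ v₂, node v = .case x v₁ v₂ → x ∉ cfdScope node v₁ ∪ cfdScope node v₂
  factor_scope : ∀ v v₁ v₂, node v = .factor v₁ v₂ → cfdScope node v₁ ∩ cfdScope node v₂ = ∅
  scope_root : cfdScope node root = Set.univ
  Ψ : X → ℝ≥0

namespace CFD

variable {X : Type}

instance (D : CFD X) : WellFoundedRelation D.V :=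
  ⟨fun w v => IsChild (fun u => (D.node u).children) v w,
    have := D.finite_V
    D.dag.wf⟩

/-- The factor `exp (-Ψ x)`. -/
noncomputable def expCost (D : CFD X) (x : X) : ℝ≥0 := Real.toNNReal (Real.exp (-(D.Ψ x : ℝ)))

/-- The quantity `q(v, ξ)`. -/
noncomputable def qNode (D : CFD X) (ξ : X → Bool) (v : D.V) : ℝ≥0 :=
  match h : D.node v with
  | .case x v₁ v₂ => bif ξ x then D.expCost x * D.qNode ξ v₁ else D.qNode ξ v₂
  | .factor v₁ v₂ => D.qNode ξ v₁ * D.qNode ξ v₂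
  | .unit => 1
  | .empty => 0
termination_by v
decreasing_by all_goals simp [IsChild, h, CFDNode.children]

/-- The quantity `Z(v)`. -/
noncomputable def zNode (D : CFD X) (v : D.V) : ℝ≥0 :=
  match h : D.node v with
  | .case x v₁ v₂ => D.expCost x * D.zNode v₁ + D.zNode v₂
  | .factor v₁ v₂ => D.zNode v₁ * D.zNode v₂
  | .unit => 1
  | .empty => 0
termination_by v
decreasing_by all_goals simp [IsChild, h, CFDNode.children]

/-- `q(ξ) = q(r, ξ)` for the root `r`. -/
noncomputable def q (D : CFD X) (ξ : X → Bool) : ℝ≥0 := D.qNode ξ D.root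

/-- The sum–product `Z = Z(r)` for the root `r`. -/
noncomputable def Z (D : CFD X) : ℝ≥0 := D.zNode D.root

end CFD

/-- The kinds of nodes of a sum–product network over the variables `X`, with their children. The
leaves are the literals `pos x` (for `x`) and `neg x` (for its negation). -/
inductive SPNNode (X V : Type)
  | sum (c₁ c₂ : ℝ≥0) (v₁ v₂ : V)
  | product (v₁ v₂ : V)
  | pos (x : X)
  | neg (x : X)

/-- The children of a node. -/
def SPNNode.children {X V : Type} : SPNNode X V → List V
  | sum _ _ v₁ v₂ => [v₁, v₂]
  | product v₁ v₂ => [v₁, v₂]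
  | pos _ => []
  | neg _ => []

/-- The variables that occur unnegated in `v` or a descendant of `v`. -/
def spnPos {X V : Type} (node : V → SPNNode X V) (v : V) : Set X :=
  {x | ∃ w, Reaches (fun u => (node u).children) v w ∧ node w = .pos x}

/-- The variables that occur negated in `v` or a descendant of `v`. -/
def spnNeg {X V : Type} (node : V → SPNNode X V) (v : V) : Set X :=
  {x | ∃ w, Reaches (fun u => (node u).children) v w ∧ node w = .neg x}

/-- The variables mentioned in `v` or a descendant of `v`. -/
def spnScope {X V : Type} (node : V → SPNNode X V) (v : V) : Set X :=
  spnPos node v ∪ spnNeg node v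

/-- A valid sum–product network whose set of variables is `X`. -/
structure SPN (X : Type) where
  V : Type
  finite_V : Finite V
  node : V → SPNNode X V
  root : V
  dag : IsRootedDAG (fun v => (node v).children) root
  sum_scope : ∀ v c₁ c₂ v₁ v₂, node v = .sum c₁ c₂ v₁ v₂ → spnScope node v₁ = spnScope node v₂
  product_scope : ∀ v v₁ v₂, node v = .product v₁ v₂ →
    spnPos node v₁ ∩ spnNeg node v₂ = ∅ ∧ spnNeg node v₁ ∩ spnPos node v₂ = ∅
  scope_root : spnScope node root = Set.univ

namespace SPN

variable {X : Type}

instance (D : SPN X) : WellFoundedRelation D.V :=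
  ⟨fun w v => IsChild (fun u => (D.node u).children) v w,
    have := D.finite_V
    D.dag.wf⟩

/-- The quantity `q(v, ξ)`. -/
noncomputable def qNode (D : SPN X) (ξ : X → Bool) (v : D.V) : ℝ≥0 :=
  match h : D.node v with
  | .sum c₁ c₂ v₁ v₂ => c₁ * D.qNode ξ v₁ + c₂ * D.qNode ξ v₂
  | .product v₁ v₂ => D.qNode ξ v₁ * D.qNode ξ v₂
  | .pos x => bif ξ x then 1 else 0
  | .neg x => bif ξ x then 0 else 1
termination_by v
decreasing_by all_goals simp [IsChild, h, SPNNode.children]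

/-- `q(ξ) = q(r, ξ)` for the root `r`. -/
noncomputable def q (D : SPN X) (ξ : X → Bool) : ℝ≥0 := D.qNode ξ D.root

/-- The sum–product: the sum of `q(ξ)` over all assignments to the variables of the network. -/
noncomputable def Z [Finite X] (D : SPN X) : ℝ≥0 := ∑ᶠ ξ : X → Bool, D.q ξ

end SPN

/-- A signature whose node labels are the Boolean variables `X`. -/
def boolSignature (X T : Type) [Finite X] [Finite T] (type : T → List X)
    (F : (t : T) → (Fin (type t).length → Bool) → ℝ≥0) : Signature.{0} where
  NodeLabel := X
  Term := T
  finite_nodeLabel := inferInstance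
  finite_term := inferInstance
  type := type
  Ω := fun _ => Bool
  F := F

/-- Every factor of `G` is an indicator factor `x = ξ(x)`, attached to a single node that is
labelled with the variable `x`. -/
def FGG.IsQuery {X T : Type} [Finite X] [Finite T] {type : T → List X}
    {F : (t : T) → (Fin (type t).length → Bool) → ℝ≥0}
    (G : FGG (boolSignature X T type F)) (ξ : X → Bool) : Prop :=
  ∀ (r : G.Rule) (e : (G.rhs r).TEdge), ∃ x : X, type ((G.rhs r).tlab e) = [x] ∧
    ∀ a : Fin (type ((G.rhs r).tlab e)).length → Bool,
      ((∀ i, a i = ξ x) → F ((G.rhs r).tlab e) a = 1) ∧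
      ((∃ i, a i ≠ ξ x) → F ((G.rhs r).tlab e) a = 0)

/-! Parts 1 and 2 rest on one device. If rules of `G` with the same left-hand side have different
sets of nonterminal edges (`FGG.Separated`), any single derivation `d` of `G` can be isolated by a
conjunction: the controlling grammar has the subtrees of `d` as nonterminals and one rule for each,
namely its topmost rule without factors. In the conjunction the tree dictates the nonterminal edges
and hence the rule of `G` (`control_derivation_unique`). So it suffices to give a grammar,
independent of `M` or `n`, that derives every unrolled graph. Derivability is proved inside the
target: `Generates` says that a region of it is derived from a nonterminal, and `Generates.rule`
assembles a region from the image of a right-hand side and the regions of its nonterminal edges,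
which may overlap only in attachment nodes.

For a plated graph, a successful run arranges the removed components in a forest
(`Succeeds.forest`): the parent of a component is the one that later absorbs the factor replacing
it, and since the run does not fail, plate sets strictly shrink from child to parent. The boundary
of a component has only plates of its parent, so all copies of the component inside one copy of the
parent attach to the same boundary copies. A recursive nonterminal `iter` can therefore produce them
one by one, while `body` produces a single copy with one `iter` per child. A dynamic model is
simpler: `rest` is attached to the current copy of `H₂` and either appends another copy or closes
with `H₃`.

In parts 3 and 4 all nonterminals have empty type. Gluing then identifies nothing, derived graphs
are disjoint unions, and sums over derivations obey `derivationSum_eq`: sum over rules, product over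
nonterminal edges. Both models become a `Diagram` with at most two rules per node. A literal is a
node with an indicator factor: alone it sums to 1, and together with the query factor `[x = ξ(x)]`
it sums to the truth value of the literal under `ξ`. This reproduces the recursions for `Z(v)` and
`q(v, ξ)`. Since the sum–product of a sum–product network is instead a sum over assignments,
`SPN.exists_expansion` writes `q(v, ξ)` as a weighted sum of indicators of assignments to the scope
of `v`; at the root each indicator holds for exactly one `ξ`. -/

/-! ## Rules over arbitrary finite types -/

/-- The data of a right-hand side whose nodes, nonterminal edges and terminal edges are elements of
arbitrary finite types. The number `tag` is the name of the first nonterminal edge. -/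
structure Shape (S : Signature.{u}) (N : Type) (ntype : N → List S.NodeLabel)
    (ℓ : List S.NodeLabel) where
  V : Type
  I : Type
  T : Type
  finite_V : Finite V
  finite_I : Finite I
  finite_T : Finite T
  labV : V → S.NodeLabel
  nlab : I → N
  natt : (e : I) → Fin (ntype (nlab e)).length → V
  natt_lab : ∀ e i, labV (natt e i) = (ntype (nlab e)).get i
  tlab : T → S.Term
  tatt : (e : T) → Fin (S.type (tlab e)).length → V
  tatt_lab : ∀ e i, labV (tatt e i) = (S.type (tlab e)).get i
  ext : Fin ℓ.length → V
  ext_lab : ∀ j, labV (ext j) = ℓ.get j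
  tag : ℕ := 0

namespace Shape

variable {S : Signature.{u}} {N : Type} {ntype : N → List S.NodeLabel} {ℓ : List S.NodeLabel}

/-- The names of the nonterminal edges. -/
noncomputable def edgeNames (R : Shape S N ntype ℓ) : Finset ℕ :=
  Finset.Ico R.tag (R.tag + Nat.card R.I)

/-- The naming of the nodes. -/
noncomputable def nodeEquiv (R : Shape S N ntype ℓ) : Finset.range (Nat.card R.V) ≃ R.V :=
  have := R.finite_V
  (Finset.equivFinOfCardEq (Finset.card_range _)).trans (Finite.equivFin R.V).symm

/-- The naming of the nonterminal edges. -/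
noncomputable def edgeEquiv (R : Shape S N ntype ℓ) : R.edgeNames ≃ R.I :=
  have := R.finite_I
  (Finset.equivFinOfCardEq (by simp [edgeNames])).trans (Finite.equivFin R.I).symm

/-- The right-hand side given by a shape. -/
noncomputable def toRHS (R : Shape S N ntype ℓ) : RHS S N ntype ℓ where
  nodes := Finset.range (Nat.card R.V)
  labV := fun v => R.labV (R.nodeEquiv v)
  nedges := R.edgeNames
  nlab := fun e => R.nlab (R.edgeEquiv e)
  natt := fun e j => R.nodeEquiv.symm (R.natt (R.edgeEquiv e) j)
  natt_lab := fun e j => by simpa using R.natt_lab (R.edgeEquiv e) j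
  TEdge := R.T
  finite_TEdge := R.finite_T
  tlab := R.tlab
  tatt := fun e j => R.nodeEquiv.symm (R.tatt e j)
  tatt_lab := fun e j => by simpa using R.tatt_lab e j
  ext := fun j => R.nodeEquiv.symm (R.ext j)
  ext_lab := fun j => by simpa using R.ext_lab j

end Shape

namespace FGG

/-- The grammar whose rules are given by shapes. -/
noncomputable def ofShapes {S : Signature.{u}} {N Rule : Type} [Finite N] [Finite Rule]
    (ntype : N → List S.NodeLabel) (lhs : Rule → N)
    (sh : (r : Rule) → Shape S N ntype (ntype (lhs r))) (start : N) (h : ntype start = []) :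
    FGG S where
  N := N
  finite_N := inferInstance
  ntype := ntype
  Rule := Rule
  finite_Rule := inferInstance
  lhs := lhs
  rhs := fun r => (sh r).toRHS
  start := start
  start_type := h

/-- Rules with the same left-hand side have different sets of nonterminal edges. -/
def Separated {S : Signature.{u}} (G : FGG S) : Prop :=
  ∀ r r', G.lhs r = G.lhs r' → (G.rhs r).nedges = (G.rhs r').nedges → r = r'

end FGG

/-! ## Embeddings of fragments -/

section Realizes

variable {S : Signature.{u}}

/-- The fragment `F` is embedded in `U`, with set of nodes `W`, set of edges `D` and external
nodes `x`. -/
structure IsEmbedding {ℓ : List S.NodeLabel} (F : Fragment S ℓ) (U : FactorGraph S) (W : Set U.V)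
    (D : Set U.E) (x : Fin ℓ.length → U.V) (f : F.V → U.V) (g : F.E → U.E) : Prop where
  injV : Function.Injective f
  rangeV : Set.range f = W
  injE : Function.Injective g
  rangeE : Set.range g = D
  labV : ∀ v, U.labV (f v) = F.labV v
  labE : ∀ e, U.labE (g e) = F.labE e
  att : ∀ e (i : ℕ) (h : i < (S.type (F.labE e)).length) (h' : i < (S.type (U.labE (g e))).length),
    U.att (g e) ⟨i, h'⟩ = f (F.att e ⟨i, h⟩)
  ext : ∀ j, f (F.ext j) = x j

/-- The fragment `F` is isomorphic to the part of `U` with nodes `W`, edges `D` and external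
nodes `x`. -/
def Realizes {ℓ : List S.NodeLabel} (F : Fragment S ℓ) (U : FactorGraph S) (W : Set U.V)
    (D : Set U.E) (x : Fin ℓ.length → U.V) : Prop :=
  ∃ f g, IsEmbedding F U W D x f g

theorem Realizes.iso {ℓ : List S.NodeLabel} {F : Fragment S ℓ} {U : FactorGraph S}
    {x : Fin ℓ.length → U.V} (h : Realizes F U Set.univ Set.univ x) :
    Nonempty (FactorGraph.Iso F.toFactorGraph U) := by
  obtain ⟨f, g, h⟩ := h
  exact ⟨{
    onV := Equiv.ofBijective f ⟨h.injV, Set.range_eq_univ.mp h.rangeV⟩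
    onE := Equiv.ofBijective g ⟨h.injE, Set.range_eq_univ.mp h.rangeE⟩
    labV_eq := h.labV
    labE_eq := h.labE
    att_eq := h.att }⟩

/-- Conditions under which the nodes `φ` and terminal edges `τ` of a right-hand side, together with
the regions `W e` and `D e` for its nonterminal edges `e`, form a decomposition of a part of `U`.
The right-hand side is given by its components. -/
structure IsDecomposition (U : FactorGraph S) {V I T : Type} {k : I → ℕ}
    (labV : V → S.NodeLabel) (natt : (e : I) → Fin (k e) → V) (tlab : T → S.Term)
    (tatt : (e : T) → Fin (S.type (tlab e)).length → V)
    (φ : V → U.V) (τ : T → U.E) (W : I → Set U.V) (D : I → Set U.E) : Prop where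
  injV : Function.Injective φ
  labV : ∀ v, U.labV (φ v) = labV v
  injE : Function.Injective τ
  labE : ∀ t, U.labE (τ t) = tlab t
  att : ∀ t (i : ℕ) (h : i < (S.type (tlab t)).length) (h' : i < (S.type (U.labE (τ t))).length),
    U.att (τ t) ⟨i, h'⟩ = φ (tatt t ⟨i, h⟩)
  inter : ∀ e v, φ v ∈ W e → ∃ j, natt e j = v
  inter' : ∀ e e' w, e ≠ e' → w ∈ W e → w ∈ W e' → w ∈ Set.range φ
  disj : ∀ t e, τ t ∉ D e
  disj' : ∀ e e' d, e ≠ e' → d ∈ D e → d ∉ D e'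

/-- The embeddings of the pieces descend to the quotient because external nodes go where the
endpoints go. The result is injective because pieces meet only in nodes that `GlueRel` already
identifies, which is what `inter` and `inter'` express, and because their edges are disjoint. -/
theorem Realizes.glue {N : Type} {ntype : N → List S.NodeLabel} {ℓ : List S.NodeLabel}
    {R : RHS S N ntype ℓ} {H : (e : R.nedges) → Fragment S (ntype (R.nlab e))}
    {U : FactorGraph S} {φ : R.nodes → U.V} {τ : R.TEdge → U.E}
    {W : R.nedges → Set U.V} {D : R.nedges → Set U.E}
    (hd : IsDecomposition U R.labV R.natt R.tlab R.tatt φ τ W D)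
    (hH : ∀ e, Realizes (H e) U (W e) (D e) fun j => φ (R.natt e j)) :
    Realizes (glue R H) U (Set.range φ ∪ ⋃ e, W e) (Set.range τ ∪ ⋃ e, D e)
      fun j => φ (R.ext j) := by
  choose f g h using hH
  -- By `inter` the node of `R` is an endpoint of `e`; injectivity of `f e` makes the node of `H e`
  -- the corresponding external node.
  have hext : ∀ e v w, φ v = f e w → Quot.mk (GlueRel R H) (.inl v) = Quot.mk _ (.inr ⟨e, w⟩) := by
    intro e v w hvw
    have hw : φ v ∈ W e := by
      rw [hvw, ← (h e).rangeV]
      exact ⟨w, rfl⟩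
    obtain ⟨j, rfl⟩ := hd.inter e v hw
    rw [← (h e).ext j] at hvw
    rw [← (h e).injV hvw]
    exact Quot.sound ⟨e, j⟩
  refine ⟨Quot.lift (Sum.elim φ fun p => f p.1 p.2) ?_, Sum.elim τ fun p => g p.1 p.2,
    ?_, ?_, ?_, ?_, ?_, ?_, ?_, ?_⟩
  · rintro _ _ ⟨e, j⟩
    exact ((h e).ext j).symm
  · rintro ⟨v | ⟨e, v⟩⟩ ⟨w | ⟨e', w⟩⟩ hvw
    · have hvw : φ v = φ w := hvw
      rw [hd.injV hvw]
    · exact hext e' v w hvw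
    · exact (hext e w v hvw.symm).symm
    · have hvw : f e v = f e' w := hvw
      by_cases he : e = e'
      · subst he
        rw [(h e).injV hvw]
      · have h1 : f e v ∈ W e := by
          rw [← (h e).rangeV]
          exact ⟨v, rfl⟩
        have h2 : f e v ∈ W e' := by
          rw [hvw, ← (h e').rangeV]
          exact ⟨w, rfl⟩
        -- A node shared by two pieces comes from a node of `R`, through which both are glued.
        obtain ⟨n, hn⟩ := hd.inter' e e' _ he h1 h2
        exact (hext e n v hn).symm.trans (hext e' n w (hn.trans hvw))
  · ext w
    simp only [Set.mem_union, Set.mem_iUnion, ← (h _).rangeV]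
    constructor
    · rintro ⟨⟨v | ⟨e, v⟩⟩, rfl⟩
      · exact Or.inl ⟨v, rfl⟩
      · exact Or.inr ⟨e, v, rfl⟩
    · rintro (⟨v, rfl⟩ | ⟨e, v, rfl⟩)
      · exact ⟨Quot.mk _ (.inl v), rfl⟩
      · exact ⟨Quot.mk _ (.inr ⟨e, v⟩), rfl⟩
  · have hD : ∀ e v, g e v ∈ D e := by
      intro e v
      rw [← (h e).rangeE]
      exact ⟨v, rfl⟩
    rintro (v | ⟨e, v⟩) (w | ⟨e', w⟩) hvw
    · rw [hd.injE hvw]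
    · have hvw : τ v = g e' w := hvw
      exact absurd (hvw ▸ hD e' w) (hd.disj v e')
    · have hvw : g e v = τ w := hvw
      exact absurd (hvw ▸ hD e v) (hd.disj w e)
    · have hvw : g e v = g e' w := hvw
      by_cases he : e = e'
      · subst he
        rw [(h e).injE hvw]
      · exact absurd (hvw ▸ hD e' w) (hd.disj' e e' _ he (hD e v))
  · ext w
    simp only [Set.mem_union, Set.mem_iUnion, ← (h _).rangeE]
    constructor
    · rintro ⟨v | ⟨e, v⟩, rfl⟩
      · exact Or.inl ⟨v, rfl⟩
      · exact Or.inr ⟨e, v, rfl⟩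
    · rintro (⟨v, rfl⟩ | ⟨e, v, rfl⟩)
      · exact ⟨.inl v, rfl⟩
      · exact ⟨.inr ⟨e, v⟩, rfl⟩
  · rintro ⟨v | ⟨e, v⟩⟩
    · exact hd.labV v
    · exact (h e).labV v
  · rintro (v | ⟨e, v⟩)
    · exact hd.labE v
    · exact (h e).labE v
  · rintro (v | ⟨e, v⟩) i hi hi'
    · exact hd.att v i hi hi'
    · exact (h e).att v i hi hi'
  · intro j
    rfl

end Realizes

/-! ## Grammars that control a derivation -/

namespace FGG

variable {S : Signature.{u}}

/-- Two derivations of the same nonterminal are equal if every nonterminal that occurs in them has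
only one rule. -/
theorem derivation_unique (K : FGG S) (P : K.N → Prop)
    (h1 : ∀ r r', P (K.lhs r) → K.lhs r = K.lhs r' → r = r')
    (h2 : ∀ r, P (K.lhs r) → ∀ e, P ((K.rhs r).nlab e)) :
    ∀ X, P X → ∀ d d' : K.Derivation X, d = d' := by
  intro X hX d
  induction d with
  | mk r kids ih =>
    intro d'
    have key : ∀ Y (d' : K.Derivation Y), Y = K.lhs r → HEq (Derivation.mk r kids) d' := by
      intro Y d' hY
      cases d' with
      | mk r' kids' =>
        obtain rfl := h1 r r' hX hY.symm
        have : kids = kids' := funext fun e => ih e (h2 r hX e) (kids' e)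
        rw [this]
    exact eq_of_heq (key _ d' rfl)

/-- The children of a derivation tree. -/
def subtrees {G : FGG S} : (Σ X, G.Derivation X) → Set (Σ X, G.Derivation X)
  | ⟨_, .mk r kids⟩ => Set.range fun e => (⟨(G.rhs r).nlab e, kids e⟩ : Σ X, G.Derivation X)

/-- Every derivation tree belongs to a finite set of derivation trees that is closed under taking
children. -/
theorem exists_closed {G : FGG S} : ∀ {X} (d : G.Derivation X),
    ∃ A : Set (Σ X, G.Derivation X), A.Finite ∧ (∀ p ∈ A, subtrees p ⊆ A) ∧ ⟨X, d⟩ ∈ A := by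
  intro X d
  induction d with
  | mk r kids ih =>
    choose A hA using ih
    refine ⟨insert ⟨_, .mk r kids⟩ (⋃ e, A e),
      (Set.finite_iUnion fun e => (hA e).1).insert _, ?_, Set.mem_insert _ _⟩
    rintro p (rfl | hp)
    · rintro _ ⟨e, rfl⟩
      exact Or.inr (Set.mem_iUnion.mpr ⟨e, (hA e).2.2⟩)
    · obtain ⟨e, he⟩ := Set.mem_iUnion.mp hp
      exact ((hA e).2.1 p he).trans ((Set.subset_iUnion A e).trans (Set.subset_insert _ _))

/-- The right-hand side for a derivation tree: that of its topmost rule, with the nonterminals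
replaced by the subtrees, and without factors. -/
def controlRHS {G : FGG S} {A : Set (Σ X, G.Derivation X)} (hA : ∀ p ∈ A, subtrees p ⊆ A) :
    (p : A) → RHS S A (fun q => G.ntype q.1.1) (G.ntype p.1.1)
  | ⟨⟨_, .mk r kids⟩, hp⟩ =>
    { nodes := (G.rhs r).nodes
      labV := (G.rhs r).labV
      nedges := (G.rhs r).nedges
      nlab := fun e => ⟨⟨_, kids e⟩, hA _ hp ⟨e, rfl⟩⟩
      natt := (G.rhs r).natt
      natt_lab := (G.rhs r).natt_lab
      TEdge := Empty
      finite_TEdge := inferInstance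
      tlab := Empty.elim
      tatt := fun e => e.elim
      tatt_lab := fun e => e.elim
      ext := (G.rhs r).ext
      ext_lab := (G.rhs r).ext_lab }

/-- The grammar that admits only the derivation tree `d`. Its nonterminals are the trees in a
finite set that contains `d` and is closed under taking children. -/
def control {G : FGG S} {A : Set (Σ X, G.Derivation X)} (hA : ∀ p ∈ A, subtrees p ⊆ A)
    (hf : A.Finite) (d : G.Derivation G.start) (hd : ⟨_, d⟩ ∈ A) : FGG S where
  N := A
  finite_N := hf
  ntype := fun q => G.ntype q.1.1
  Rule := A
  finite_Rule := hf
  lhs := id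
  rhs := controlRHS hA
  start := ⟨⟨_, d⟩, hd⟩
  start_type := G.start_type

theorem control_factorFree {G : FGG S} {A : Set (Σ X, G.Derivation X)}
    (hA : ∀ p ∈ A, subtrees p ⊆ A) (hf : A.Finite) (d : G.Derivation G.start) (hd : ⟨_, d⟩ ∈ A) :
    (control hA hf d hd).FactorFree := by
  rintro ⟨⟨_, r, kids⟩, hp⟩
  exact inferInstanceAs (IsEmpty Empty)

/-- At a pair `(X, d)` with `d` a tree for `X`, the control grammar has one rule, and its partner in
`G` has the left-hand side and the nonterminal edges of the topmost rule of `d`; separation leaves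
no choice. The children are again such pairs. -/
theorem control_derivation_unique {G : FGG S} (hG : G.Separated) {A : Set (Σ X, G.Derivation X)}
    (hA : ∀ p ∈ A, subtrees p ⊆ A) (hf : A.Finite) (d : G.Derivation G.start) (hd : ⟨_, d⟩ ∈ A)
    (d₁ d₂ : (G.conj (control hA hf d hd)).Derivation (G.conj (control hA hf d hd)).start) :
    d₁ = d₂ := by
  have key : ∀ (r : G.Rule) (p : A), Conjoinable G (control hA hf d hd) r p → p.1.1 = G.lhs r →
      ∃ kids h, p = ⟨⟨_, .mk r kids⟩, h⟩ := by
    rintro r ⟨⟨_, r', kids⟩, hp⟩ hc h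
    obtain rfl := hG r r' h.symm hc.nedges_eq
    exact ⟨kids, hp, rfl⟩
  -- The conjunction also has nonterminals that pair a symbol with a tree for another symbol of the
  -- same type. The predicate excludes them; it holds at the start and is inherited by children.
  refine derivation_unique _
    (fun X : {p : G.N × A // G.ntype p.1 = G.ntype p.2.1.1} => X.1.2.1.1 = X.1.1) ?_ ?_ _ rfl d₁ d₂
  · rintro ⟨⟨r, p⟩, hc⟩ ⟨⟨r', p'⟩, hc'⟩ hp h
    have h1 : G.lhs r = G.lhs r' := congrArg (fun x => x.1.1) h
    have h2 : p = p' := congrArg (fun x => x.1.2) h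
    subst h2
    obtain ⟨kids, hk, rfl⟩ := key r p hc hp
    obtain rfl := hG r' r h1.symm hc'.nedges_eq
    rfl
  · rintro ⟨⟨r, p⟩, hc⟩ hp e
    obtain ⟨kids, hk, rfl⟩ := key r p hc hp
    rfl

/-- `G.Generates U X W D x` says that the part of `U` with nodes `W`, edges `D` and external nodes
`x` is the derived graph of a derivation of `X`, even when the derivation is controlled. -/
def Generates (G : FGG S) (U : FactorGraph S) (X : G.N) (W : Set U.V) (D : Set U.E)
    (x : Fin (G.ntype X).length → U.V) : Prop :=
  ∃ d : G.Derivation X, ∀ (A : Set (Σ X, G.Derivation X)) (hA : ∀ p ∈ A, subtrees p ⊆ A)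
    (hf : A.Finite) (d₀ : G.Derivation G.start) (hd₀ : ⟨_, d₀⟩ ∈ A) (hd : ⟨X, d⟩ ∈ A),
    ∃ d' : (G.conj (control hA hf d₀ hd₀)).Derivation ⟨(X, ⟨⟨X, d⟩, hd⟩), rfl⟩,
      Realizes d'.derived U W D x

/-- Reduces parts 1 and 2 to deriving the whole target from the start symbol. Derivation trees are
finite, so the control grammar is finite. -/
theorem Generates.exists_control {G : FGG S} (hG : G.Separated) {U : FactorGraph S}
    {x : Fin (G.ntype G.start).length → U.V} (h : G.Generates U G.start Set.univ Set.univ x) :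
    ∃ G' : FGG S, G'.FactorFree ∧ (G.conj G').GeneratesExactly U := by
  obtain ⟨d, h⟩ := h
  obtain ⟨A, hf, hA, hd⟩ := exists_closed d
  obtain ⟨d', h'⟩ := h A hA hf d hd hd
  exact ⟨control hA hf d hd, control_factorFree hA hf d hd, d',
    fun _ => control_derivation_unique hG hA hf d hd _ _, h'.iso⟩

/-- Any closed `A` that contains the new tree contains its children, so these are controlled by the
same grammar. This is why `Generates` quantifies over all `A` and over the start tree `d₀`. -/
theorem Generates.rule {G : FGG S} {U : FactorGraph S} (r : G.Rule) {φ : (G.rhs r).nodes → U.V}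
    {τ : (G.rhs r).TEdge → U.E} {W : (G.rhs r).nedges → Set U.V} {D : (G.rhs r).nedges → Set U.E}
    (hd : IsDecomposition U (G.rhs r).labV (G.rhs r).natt (G.rhs r).tlab (G.rhs r).tatt φ τ W D)
    (h : ∀ e, G.Generates U _ (W e) (D e) fun j => φ ((G.rhs r).natt e j)) :
    G.Generates U (G.lhs r) (Set.range φ ∪ ⋃ e, W e) (Set.range τ ∪ ⋃ e, D e)
      fun j => φ ((G.rhs r).ext j) := by
  choose d h using h
  refine ⟨.mk r d, fun A hA hf d₀ hd₀ hdA => ?_⟩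
  have hkids : ∀ e, ⟨_, d e⟩ ∈ A := fun e => hA _ hdA ⟨e, rfl⟩
  choose d' h' using fun e => h e A hA hf d₀ hd₀ (hkids e)
  have hc : Conjoinable G (control hA hf d₀ hd₀) r ⟨⟨_, .mk r d⟩, hdA⟩ :=
    ⟨rfl, rfl, fun _ _ _ => rfl, rfl, fun _ _ _ => rfl, fun _ _ _ _ _ _ => rfl,
      fun _ _ _ => rfl⟩
  let K := G.conj (control hA hf d₀ hd₀)
  let r' : K.Rule := ⟨(r, ⟨⟨_, .mk r d⟩, hdA⟩), hc⟩
  -- The control rule contributes no factors, so the second summand of the terminal edges is empty.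
  let τ' : (K.rhs r').TEdge → U.E := Sum.elim τ Empty.elim
  have hτ : Set.range τ' = Set.range τ := by
    ext t
    constructor
    · rintro ⟨t | t, rfl⟩
      · exact ⟨t, rfl⟩
      · exact t.elim
    · rintro ⟨t, rfl⟩
      exact ⟨.inl t, rfl⟩
  have hd' : IsDecomposition U (K.rhs r').labV (K.rhs r').natt (K.rhs r').tlab (K.rhs r').tatt
      φ τ' W D :=
    { injV := hd.injV
      labV := hd.labV
      injE := by
        rintro (t | t) (t' | t') htt
        · rw [hd.injE htt]
        · exact t'.elim
        · exact t.elim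
        · exact t.elim
      labE := by
        rintro (t | t)
        · exact hd.labE t
        · exact t.elim
      att := by
        rintro (t | t)
        · exact hd.att t
        · exact t.elim
      inter := hd.inter
      inter' := hd.inter'
      disj := by
        rintro (t | t)
        · exact hd.disj t
        · exact t.elim
      disj' := hd.disj' }
  rw [← hτ]
  exact ⟨.mk (G := K) r' d', Realizes.glue hd' h'⟩

/-- A decomposition according to a rule given by a shape. -/
theorem Generates.shape {N Rule : Type} [Finite N] [Finite Rule] {ntype : N → List S.NodeLabel}
    {lhs : Rule → N} {sh : (r : Rule) → Shape S N ntype (ntype (lhs r))} {start : N}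
    {hs : ntype start = []} {U : FactorGraph S} (r : Rule) {φ : (sh r).V → U.V}
    {τ : (sh r).T → U.E} {W : (sh r).I → Set U.V} {D : (sh r).I → Set U.E}
    (hd : IsDecomposition U (sh r).labV (sh r).natt (sh r).tlab (sh r).tatt φ τ W D)
    (h : ∀ e, (ofShapes ntype lhs sh start hs).Generates U ((sh r).nlab e) (W e) (D e)
      fun j => φ ((sh r).natt e j)) :
    (ofShapes ntype lhs sh start hs).Generates U (lhs r) (Set.range φ ∪ ⋃ e, W e)
      (Set.range τ ∪ ⋃ e, D e) fun j => φ ((sh r).ext j) := by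
  let n := (sh r).nodeEquiv
  let k := (sh r).edgeEquiv
  have hd' : IsDecomposition U (sh r).toRHS.labV (sh r).toRHS.natt (sh r).toRHS.tlab
      (sh r).toRHS.tatt (φ ∘ n) τ (W ∘ k) (D ∘ k) :=
    { injV := hd.injV.comp n.injective
      labV := fun v => hd.labV _
      injE := hd.injE
      labE := hd.labE
      att := fun t i hi hi' => by simpa [Shape.toRHS, n] using hd.att t i hi hi'
      inter := fun e v hv => by
        obtain ⟨j, hj⟩ := hd.inter _ _ hv
        exact ⟨j, n.symm_apply_eq.mpr hj⟩
      inter' := fun e e' w he hw hw' => by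
        obtain ⟨v, hv⟩ := hd.inter' _ _ w (k.injective.ne he) hw hw'
        exact ⟨n.symm v, (congrArg φ (n.apply_symm_apply v)).trans hv⟩
      disj := fun t e => hd.disj t _
      disj' := fun e e' d he => hd.disj' _ _ d (k.injective.ne he) }
  have hk : ∀ e, (ofShapes ntype lhs sh start hs).Generates U ((sh r).nlab (k e)) (W (k e))
      (D (k e)) fun j => φ (n (n.symm ((sh r).natt (k e) j))) := fun e => by
    simpa only [Equiv.apply_symm_apply] using h (k e)
  have key := Generates.rule (G := ofShapes ntype lhs sh start hs) r hd' hk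
  have h1 : Set.range (φ ∘ n) = Set.range φ := n.surjective.range_comp φ
  have h2 : ⋃ e, (W ∘ k) e = ⋃ e, W e := k.surjective.iUnion_comp W
  have h3 : ⋃ e, (D ∘ k) e = ⋃ e, D e := k.surjective.iUnion_comp D
  have h4 : (fun j => (φ ∘ n) (n.symm ((sh r).ext j))) = fun j => φ ((sh r).ext j) := by
    simp only [Function.comp_apply, Equiv.apply_symm_apply]
  rw [← h1, ← h2, ← h3]
  exact cast (congrArg (Generates (ofShapes ntype lhs sh start hs) U (lhs r) _ _) h4) key

/-- The form used for concrete grammars: the target region is compared with the union elementwise.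
-/
theorem Generates.shape' {N Rule : Type} [Finite N] [Finite Rule] {ntype : N → List S.NodeLabel}
    {lhs : Rule → N} {sh : (r : Rule) → Shape S N ntype (ntype (lhs r))} {start : N}
    {hs : ntype start = []} {U : FactorGraph S} (r : Rule) (φ : (sh r).V → U.V)
    (τ : (sh r).T → U.E) (W : (sh r).I → Set U.V) (D : (sh r).I → Set U.E) {W' : Set U.V}
    {D' : Set U.E} {x : Fin (ntype (lhs r)).length → U.V}
    (hd : IsDecomposition U (sh r).labV (sh r).natt (sh r).tlab (sh r).tatt φ τ W D)
    (h : ∀ e, (ofShapes ntype lhs sh start hs).Generates U ((sh r).nlab e) (W e) (D e)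
      fun j => φ ((sh r).natt e j))
    (hW : ∀ w, w ∈ W' ↔ (∃ v, φ v = w) ∨ ∃ e, w ∈ W e)
    (hD : ∀ d, d ∈ D' ↔ (∃ t, τ t = d) ∨ ∃ e, d ∈ D e) (hx : ∀ j, x j = φ ((sh r).ext j)) :
    (ofShapes ntype lhs sh start hs).Generates U (lhs r) W' D' x := by
  have h1 : W' = Set.range φ ∪ ⋃ e, W e := by
    ext w
    simp [hW]
  have h2 : D' = Set.range τ ∪ ⋃ e, D e := by
    ext d
    simp [hD]
  rw [h1, h2, funext hx]
  exact Generates.shape r hd h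

end FGG

/-! ## Attachment along a list of nodes -/

section ListAtt

variable {V L : Type}

/-- The sequence of the elements of a list, indexed by the positions of the list of their labels. -/
def listAtt (l : List V) (f : V → L) (j : Fin (l.map f).length) : V :=
  l.get (j.cast (by simp))

theorem listAtt_lab (l : List V) (f : V → L) (j : Fin (l.map f).length) :
    f (listAtt l f j) = (l.map f).get j := by
  simp [listAtt]

theorem listAtt_mem (l : List V) (f : V → L) (j : Fin (l.map f).length) : listAtt l f j ∈ l :=
  List.get_mem _ _

theorem exists_listAtt {l : List V} (f : V → L) {v : V} (h : v ∈ l) :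
    ∃ j, listAtt l f j = v := by
  obtain ⟨j, rfl⟩ := List.get_of_mem h
  exact ⟨j.cast (by simp), rfl⟩

end ListAtt

/-! ## The forest of components of a plated graph -/

/-- The components that are removed in a successful run of tensor variable elimination. Every node
and every edge is owned by a component, whose plate set is that of the node or edge. The parent of
a component is the component that contains the factor which replaces it, and `bd c` is the
boundary of `c`. -/
structure PlateForest {B V E : Type} (Inc : V → E → Prop) (plateV : V → Set B)
    (plateE : E → Set B) where
  I : Type
  finite_I : Finite I
  own : V → I
  ownE : E → I
  P : I → Set B
  parent : I → Option I
  bd : I → Set V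
  P_own : ∀ v, P (own v) = plateV v
  P_ownE : ∀ e, P (ownE e) = plateE e
  inc : ∀ v e, Inc v e → own v = ownE e ∨ v ∈ bd (ownE e)
  parent_lt : ∀ c p, parent c = some p → P p ⊂ P c
  bd_parent : ∀ c, ∀ v ∈ bd c, ∃ p, parent c = some p ∧ (own v = p ∨ v ∈ bd p)
  bd_lt : ∀ c, ∀ v ∈ bd c, plateV v ⊂ P c

namespace PlatedGraph

variable {B : Type}

theorem leaf_component_eq {K : PlatedGraph B} {L : Set B} {v : K.V} {e : K.E}
    (hv : K.plateV v = L) (he : K.plateE e = L) (h : K.Inc v e) :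
    (K.leaf L).connectedComponentMk (.inl ⟨v, hv⟩) =
      (K.leaf L).connectedComponentMk (.inr ⟨e, he⟩) := by
  apply SimpleGraph.ConnectedComponent.sound
  apply SimpleGraph.Adj.reachable
  rw [leaf, SimpleGraph.fromRel_adj]
  exact ⟨by simp, Or.inl ⟨_, _, rfl, rfl, h⟩⟩

theorem plateV_ne_of_mem_boundary {K : PlatedGraph B} {L : Set B}
    {c : (K.leaf L).ConnectedComponent} {v : K.V} (h : v ∈ K.boundary L c) : K.plateV v ≠ L := by
  intro hv
  obtain ⟨h1, e, he, hc, hi⟩ := h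
  exact h1 hv ((leaf_component_eq hv he hi).trans hc)

theorem plateV_ssubset_of_mem_boundary {K : PlatedGraph B} {L : Set B}
    (hsub : ∀ v e, K.Inc v e → K.plateV v ⊆ K.plateE e)
    {c : (K.leaf L).ConnectedComponent} {v : K.V} (h : v ∈ K.boundary L c) : K.plateV v ⊂ L := by
  refine Set.ssubset_iff_subset_ne.mpr ⟨?_, plateV_ne_of_mem_boundary h⟩
  obtain ⟨h1, e, he, hc, hi⟩ := h
  exact he ▸ hsub v e hi

open Classical in
/-- The components of a step, added to the components of the rest of the run. -/
noncomputable def extendForest [Finite B] (K : PlatedGraph B) [Finite K.V] [Finite K.E]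
    (hsub : ∀ v e, K.Inc v e → K.plateV v ⊆ K.plateE e) (L : Set B)
    (hmax : ∀ e, (K.plateE e).ncard ≤ L.ncard)
    (hok : ∀ c : (K.leaf L).ConnectedComponent, (K.boundary L c).Nonempty → K.nextPlates L c ≠ L)
    (C : PlateForest (K.reduce L).Inc (K.reduce L).plateV (K.reduce L).plateE) :
    PlateForest K.Inc K.plateV K.plateE where
  I := C.I ⊕ (K.leaf L).ConnectedComponent
  finite_I := by
    have := C.finite_I
    have : Finite (K.leaf L).ConnectedComponent := Quot.finite _
    infer_instance
  own := fun v => if h : K.plateV v = L then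
    .inr ((K.leaf L).connectedComponentMk (.inl ⟨v, h⟩)) else .inl (C.own ⟨v, h⟩)
  ownE := fun e => if h : K.plateE e = L then
    .inr ((K.leaf L).connectedComponentMk (.inr ⟨e, h⟩)) else .inl (C.ownE (.inl ⟨e, h⟩))
  P := Sum.elim C.P fun _ => L
  parent := Sum.elim (fun c => (C.parent c).map .inl) fun c =>
    if h : (K.boundary L c).Nonempty then some (.inl (C.ownE (.inr ⟨c, h⟩))) else none
  bd := Sum.elim (fun c => {v | ∃ h : K.plateV v ≠ L, ⟨v, h⟩ ∈ C.bd c}) (K.boundary L)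
  P_own := fun v => by
    by_cases h : K.plateV v = L
    · simp [h]
    · simp only [h, dif_neg, not_false_iff, Sum.elim_inl]
      exact C.P_own ⟨v, h⟩
  P_ownE := fun e => by
    by_cases h : K.plateE e = L
    · simp [h]
    · simp only [h, dif_neg, not_false_iff, Sum.elim_inl]
      exact C.P_ownE (.inl ⟨e, h⟩)
  inc := fun v e hi => by
    by_cases he : K.plateE e = L
    · by_cases hv : K.plateV v = L
      · left
        simp only [he, hv, dif_pos, leaf_component_eq hv he hi]
      · right
        simp only [he, dif_pos]
        exact ⟨fun h => absurd h hv, e, he, rfl, hi⟩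
    · have hv : K.plateV v ≠ L := by
        intro hv
        have h1 : L ⊆ K.plateE e := hv ▸ hsub v e hi
        exact he (Set.eq_of_subset_of_ncard_le h1 (hmax e)).symm
      simp only [he, hv, dif_neg, not_false_iff]
      rcases C.inc ⟨v, hv⟩ (.inl ⟨e, he⟩) hi with h | h
      · exact Or.inl (congrArg _ h)
      · exact Or.inr ⟨hv, h⟩
  parent_lt := by
    rintro (c | c) p hp
    · simp only [Sum.elim_inl, Option.map_eq_some_iff] at hp
      obtain ⟨p, hp, rfl⟩ := hp
      exact C.parent_lt c p hp
    · simp only [Sum.elim_inr] at hp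
      split_ifs at hp with h
      cases hp
      have h1 : C.P (C.ownE (.inr ⟨c, h⟩)) = K.nextPlates L c := C.P_ownE (.inr ⟨c, h⟩)
      simp only [Sum.elim_inl, Sum.elim_inr, h1]
      -- Properness of the inclusion is exactly the condition that the run does not fail at `c`.
      exact Set.ssubset_iff_subset_ne.mpr ⟨Set.iUnion₂_subset fun v hv =>
        (plateV_ssubset_of_mem_boundary hsub hv).subset, hok c h⟩
  bd_parent := by
    rintro (c | c) v hv
    · obtain ⟨h, hv⟩ := hv
      obtain ⟨p, hp, hvp⟩ := C.bd_parent c _ hv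
      refine ⟨.inl p, by simp [hp], ?_⟩
      rcases hvp with rfl | hvp
      · left
        simp [h]
      · exact Or.inr ⟨h, hvp⟩
    · have h : (K.boundary L c).Nonempty := ⟨v, hv⟩
      have hL := plateV_ne_of_mem_boundary hv
      refine ⟨.inl (C.ownE (.inr ⟨c, h⟩)), by simp [h], ?_⟩
      -- Boundary variables are the endpoints of the new factor, so in the rest of the run they lie
      -- in the component owning that factor or in its boundary.
      rcases C.inc ⟨v, hL⟩ (.inr ⟨c, h⟩) hv with h' | h'
      · left
        simp [hL, h']
      · exact Or.inr ⟨hL, h'⟩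
  bd_lt := by
    rintro (c | c) v hv
    · obtain ⟨h, hv⟩ := hv
      exact C.bd_lt c _ hv
    · exact plateV_ssubset_of_mem_boundary hsub hv

/-- Each step of the run adds its components as new leaves to the forest of the rest of the run.
When no factor remains, every remaining variable is a component of its own, without parent. -/
theorem Succeeds.forest [Finite B] {K : PlatedGraph B} (hK : K.Succeeds) :
    Finite K.V → Finite K.E → (∀ v e, K.Inc v e → K.plateV v ⊆ K.plateE e) →
      Nonempty (PlateForest K.Inc K.plateV K.plateE) := by
  induction hK with
  | done K h =>
    intro hV _ _
    exact ⟨{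
      I := K.V
      finite_I := hV
      own := id
      ownE := h.elim
      P := K.plateV
      parent := fun _ => none
      bd := fun _ => ∅
      P_own := fun _ => rfl
      P_ownE := h.elim
      inc := fun _ => h.elim
      parent_lt := by simp
      bd_parent := by simp
      bd_lt := by simp }⟩
  | step K e hmax hok hrest ih =>
    intro hV hE hsub
    have : Finite (K.leaf (K.plateE e)).ConnectedComponent := Quot.finite _
    obtain ⟨C⟩ := ih (inferInstanceAs (Finite {v // _})) (inferInstanceAs (Finite ({v // _} ⊕ {c // _})))
      (by
        rintro v (e' | c) hi
        · exact hsub _ _ hi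
        · exact Set.subset_biUnion_of_mem (u := fun v => K.plateV v) hi)
    exact ⟨extendForest K hsub _ hmax hok C⟩

end PlatedGraph

namespace PlateForest

/-! ## Indices of copies -/

/-- A choice of an instance of every plate in `s`. -/
abbrev Idx {B : Type} (M : B → ℕ) (s : Set B) : Type := (b : s) → Fin (M b)

namespace Idx

variable {B : Type} {M : B → ℕ} {s t u : Set B}

/-- Restriction of indices. -/
def res (i : Idx M s) (h : t ⊆ s) : Idx M t := fun b => i ⟨b.1, h b.2⟩

/-- Two indices agree on the plates that they have in common. -/
def Agree (i : Idx M s) (j : Idx M t) : Prop :=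
  ∀ b (h : b ∈ s) (h' : b ∈ t), i ⟨b, h⟩ = j ⟨b, h'⟩

theorem agree_res (i : Idx M s) (h : t ⊆ s) : i.Agree (i.res h) := fun _ _ _ => rfl

theorem res_agree (i : Idx M s) (h : t ⊆ s) : (i.res h).Agree i := fun _ _ _ => rfl

/-- Agreement is not transitive in general: a plate common to the outer two sets must also lie in
the middle one. -/
theorem Agree.trans {i : Idx M s} {j : Idx M t} {k : Idx M u} (h : i.Agree j) (h' : j.Agree k)
    (hs : s ∩ u ⊆ t) : i.Agree k :=
  fun b hb hb' => (h b hb (hs ⟨hb, hb'⟩)).trans (h' b (hs ⟨hb, hb'⟩) hb')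

theorem Agree.eq {i j : Idx M s} (h : i.Agree j) : i = j := funext fun b => h b b.2 b.2

theorem Agree.res_eq {i : Idx M s} {j : Idx M t} (h : i.Agree j) (hs : t ⊆ s) : i.res hs = j :=
  funext fun b => h b _ b.2

end Idx

/-! ## The grammar of a forest of components -/

section Forest

variable {B V E : Type} {Inc : V → E → Prop} {plateV : V → Set B} {plateE : E → Set B}
  (C : PlateForest Inc plateV plateE)

/-- The nodes outside a component, or outside the whole graph (`none`), to which it is attached. -/
def bdO : Option C.I → Set V
  | none => ∅
  | some c => C.bd c

/-- The plates of a component; the whole graph has none. -/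
def PO : Option C.I → Set B
  | none => ∅
  | some c => C.P c

/-- `C.Below a o` says that `o` is `a` or an ancestor of `a`. -/
def Below : Option C.I → Option C.I → Prop :=
  Relation.ReflTransGen fun a o => ∃ c, a = some c ∧ C.parent c = o

variable {C}

theorem PO_subset_of_parent {c : C.I} {o : Option C.I} (h : C.parent c = o) : C.PO o ⊆ C.P c := by
  subst h
  match h : C.parent c with
  | none => exact Set.empty_subset _
  | some p => exact (C.parent_lt c p h).subset

theorem Below.of_eq {a o : Option C.I} (h : a = o) : C.Below a o :=
  h ▸ Relation.ReflTransGen.refl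

theorem Below.PO_subset {a o : Option C.I} (h : C.Below a o) : C.PO o ⊆ C.PO a := by
  induction h with
  | refl => exact subset_rfl
  | tail _ h ih =>
    obtain ⟨c, rfl, h⟩ := h
    exact (PO_subset_of_parent h).trans ih

theorem Below.PO_subset_plateV {v : V} {o : Option C.I} (h : C.Below (some (C.own v)) o) :
    C.PO o ⊆ plateV v :=
  C.P_own v ▸ h.PO_subset

theorem Below.PO_subset_plateE {e : E} {o : Option C.I} (h : C.Below (some (C.ownE e)) o) :
    C.PO o ⊆ plateE e :=
  C.P_ownE e ▸ h.PO_subset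

/-- Everything below a component has all of its plates, while a boundary node misses at least one.
-/
theorem not_below_of_mem_bdO {v : V} {o : Option C.I} (h : v ∈ C.bdO o) :
    ¬ C.Below (some (C.own v)) o := by
  intro hb
  match o with
  | none => exact h
  | some c => exact (C.bd_lt c v h).not_subset hb.PO_subset_plateV

theorem not_below_parent (c : C.I) : ¬ C.Below (C.parent c) (some c) := by
  intro hb
  match h : C.parent c with
  | none =>
    rw [h] at hb
    rcases Relation.ReflTransGen.cases_head hb with h | ⟨_, ⟨c', h, -⟩, -⟩ <;> simp at h
  | some p =>
    rw [h] at hb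
    exact (C.parent_lt c p h).not_subset hb.PO_subset

theorem below_parent (c : C.I) : C.Below (some c) (C.parent c) :=
  Relation.ReflTransGen.single ⟨c, rfl, rfl⟩

/-- The ancestors of `a` form a chain, so `c` and `c'` are comparable; if they differed, their
common parent would lie below one of them. Hence siblings have disjoint subtrees. -/
theorem Below.unique {a : Option C.I} {c c' : C.I} (h : C.Below a (some c))
    (h' : C.Below a (some c')) (hp : C.parent c = C.parent c') : c = c' := by
  have hr : Relator.RightUnique fun (a o : Option C.I) => ∃ c, a = some c ∧ C.parent c = o := by
    rintro _ o o' ⟨c, rfl, rfl⟩ ⟨c', h, rfl⟩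
    rw [Option.some.inj h]
  have key : ∀ c c' : C.I, C.Below (some c) (some c') → C.parent c = C.parent c' → c = c' := by
    intro c c' h hp
    rcases Relation.ReflTransGen.cases_head h with h | ⟨_, ⟨d, hd, rfl⟩, h⟩
    · exact Option.some.inj h
    · rw [← Option.some.inj hd, hp] at h
      exact absurd h (not_below_parent c')
  rcases Relation.ReflTransGen.total_of_right_unique hr h h' with h | h
  · exact key _ _ h hp
  · exact (key _ _ h hp.symm).symm

theorem below_none [Finite B] (c : C.I) : C.Below (some c) none := by
  have : WellFounded fun c c' : C.I => C.P c < C.P c' := InvImage.wf C.P wellFounded_lt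
  induction c using this.induction with
  | _ c ih =>
    match h : C.parent c with
    | none => exact h ▸ below_parent c
    | some p => exact (h ▸ below_parent c : C.Below (some c) (some p)).trans (ih p (C.parent_lt c p h))

/-- Ensures that the endpoints of the edge for a child are nodes of the right-hand side of its
parent. -/
theorem mem_bd {v : V} {c : C.I} {o : Option C.I} (h : v ∈ C.bd c) (hp : C.parent c = o) :
    some (C.own v) = o ∨ v ∈ C.bdO o := by
  obtain ⟨p, hp', h⟩ := C.bd_parent c v h
  obtain rfl := hp.symm.trans hp'
  exact h.imp (congrArg some) id

/-- Makes `copyV` applicable: an index of a copy of `o` selects one copy of every node in the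
right-hand side of `o`. -/
theorem plateV_subset_PO {v : V} {o : Option C.I} (h : some (C.own v) = o ∨ v ∈ C.bdO o) :
    plateV v ⊆ C.PO o := by
  rcases h with rfl | h
  · exact (C.P_own v).symm.subset
  · match o with
    | none => exact h.elim
    | some c => exact (C.bd_lt c v h).subset

variable (C) in
/-- The nonterminals: `body o` generates one copy of a component and its descendants, and `iter c`
generates the copies of `c` that have the same parent. -/
inductive Nonterm
  | body (o : Option C.I)
  | iter (c : C.I)

variable (C) in
/-- The rules. -/
inductive GRule
  | body (o : Option C.I)
  | step (c : C.I)
  | halt (c : C.I)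

instance : Finite C.Nonterm := by
  have := C.finite_I
  exact Finite.of_surjective (fun x : Option C.I ⊕ C.I => Sum.elim Nonterm.body Nonterm.iter x) (by
    rintro (o | c)
    · exact ⟨.inl o, rfl⟩
    · exact ⟨.inr c, rfl⟩)

instance : Finite C.GRule := by
  have := C.finite_I
  exact Finite.of_surjective (fun x : Option C.I ⊕ C.I ⊕ C.I =>
    Sum.elim GRule.body (Sum.elim GRule.step GRule.halt) x) (by
      rintro (o | c | c)
      · exact ⟨.inl o, rfl⟩
      · exact ⟨.inr (.inl c), rfl⟩
      · exact ⟨.inr (.inr c), rfl⟩)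

/-- The left-hand side of a rule. -/
def GRule.lhs : C.GRule → C.Nonterm
  | .body o => .body o
  | .step c => .iter c
  | .halt c => .iter c

variable [Finite V]

variable (C) in
/-- The sequence of external nodes of a component. -/
noncomputable def bdList (o : Option C.I) : List V :=
  (Set.toFinite (C.bdO o)).toFinset.toList

theorem mem_bdList {o : Option C.I} {v : V} : v ∈ C.bdList o ↔ v ∈ C.bdO o := by
  simp [bdList]

theorem bdList_none : C.bdList none = [] := by
  simp [bdList, bdO]

/-- The external nodes of a nonterminal. -/
noncomputable def Nonterm.nodes : C.Nonterm → List V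
  | .body o => C.bdList o
  | .iter c => C.bdList (some c)

end Forest

/-! ### Copies of nodes and edges in the unrolled graph -/

section Copies

variable {S : Signature.{u}} {B : Type} {H : PFG S B} [Finite B] {M : B → ℕ}

/-- The copy of a node with a given index. -/
def copyV {s : Set B} (i : Idx M s) (v : H.V) (h : H.plateV v ⊆ s) : (H.unroll M).V :=
  ⟨v, i.res h⟩

/-- The copy of an edge with a given index. -/
def copyE {s : Set B} (i : Idx M s) (e : H.E) (h : H.plateE e ⊆ s) : (H.unroll M).E :=
  ⟨e, i.res h⟩

theorem copyV_inj {s t : Set B} {i : Idx M s} {j : Idx M t} {v w : H.V} {h : H.plateV v ⊆ s}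
    {h' : H.plateV w ⊆ t} (he : copyV i v h = copyV j w h') : v = w :=
  congrArg Sigma.fst he

theorem copyE_inj {s t : Set B} {i : Idx M s} {j : Idx M t} {v w : H.E} {h : H.plateE v ⊆ s}
    {h' : H.plateE w ⊆ t} (he : copyE i v h = copyE j w h') : v = w :=
  congrArg Sigma.fst he

theorem copyV_eq {s : Set B} {i : Idx M s} {p : (H.unroll M).V} (h : H.plateV p.1 ⊆ s)
    (ha : i.Agree p.2) : copyV i p.1 h = p := by
  obtain ⟨v, j⟩ := p
  exact congrArg _ (ha.res_eq h)

theorem copyE_eq {s : Set B} {i : Idx M s} {p : (H.unroll M).E} (h : H.plateE p.1 ⊆ s)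
    (ha : i.Agree p.2) : copyE i p.1 h = p := by
  obtain ⟨v, j⟩ := p
  exact congrArg _ (ha.res_eq h)

theorem copyV_congr {s t : Set B} {i : Idx M s} {j : Idx M t} (hij : i.Agree j) {v : H.V}
    (h : H.plateV v ⊆ s) (h' : H.plateV v ⊆ t) : copyV i v h = copyV j v h' :=
  congrArg (Sigma.mk v) (funext fun b => hij b (h b.2) (h' b.2))

end Copies

/-! ### The grammar of a plated factor graph -/

section Grammar

variable {S : Signature.{u}} {B : Type} {H : PFG S B}
  (C : PlateForest (fun v e => ∃ i, H.att e i = v) H.plateV H.plateE) [Finite H.V]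

/-- The type of a nonterminal. -/
noncomputable abbrev ntype (X : C.Nonterm) : List S.NodeLabel := X.nodes.map H.labV

variable {C} in
theorem listAtt_plate_body {o : Option C.I} (j : Fin (C.ntype (.body o)).length) :
    H.plateV (listAtt (C.bdList o) H.labV j) ⊆ C.PO o :=
  plateV_subset_PO (Or.inr (mem_bdList.mp (listAtt_mem _ _ j)))

variable {C} in
theorem listAtt_plate_iter {c : C.I} (j : Fin (C.ntype (.iter c)).length) :
    H.plateV (listAtt (C.bdList (some c)) H.labV j) ⊆ C.PO (C.parent c) :=
  plateV_subset_PO (mem_bd (mem_bdList.mp (listAtt_mem _ _ j)) rfl)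

variable [Finite H.E]

/-- The right-hand sides. -/
noncomputable def shape : (r : C.GRule) → Shape S C.Nonterm C.ntype (C.ntype r.lhs)
  | .body o =>
    { V := {v : H.V // some (C.own v) = o ∨ v ∈ C.bdO o}
      I := {c : C.I // C.parent c = o}
      T := {e : H.E // some (C.ownE e) = o}
      finite_V := inferInstance
      finite_I := by
        have := C.finite_I
        infer_instance
      finite_T := inferInstance
      labV := fun v => H.labV v
      nlab := fun c => .iter c.1
      natt := fun c j => ⟨listAtt (C.bdList (some c.1)) H.labV j,
        mem_bd (mem_bdList.mp (listAtt_mem _ _ j)) c.2⟩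
      natt_lab := fun c j => listAtt_lab _ _ j
      tlab := fun e => H.labE e
      tatt := fun e j => ⟨H.att e j, by
        obtain ⟨e, rfl⟩ := e
        exact (C.inc _ e ⟨j, rfl⟩).imp (congrArg some) id⟩
      tatt_lab := fun e j => H.att_lab e j
      ext := fun j => ⟨listAtt (C.bdList o) H.labV j, Or.inr (mem_bdList.mp (listAtt_mem _ _ j))⟩
      ext_lab := fun j => listAtt_lab _ _ j }
  | .step c =>
    { V := {v : H.V // v ∈ C.bdList (some c)}
      I := Bool
      T := Empty
      finite_V := inferInstance
      finite_I := inferInstance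
      finite_T := inferInstance
      labV := fun v => H.labV v
      nlab := fun b => match b with
        | true => .body (some c)
        | false => .iter c
      natt := fun b => match b with
        | true => fun j => ⟨listAtt (C.bdList (some c)) H.labV j, listAtt_mem _ _ j⟩
        | false => fun j => ⟨listAtt (C.bdList (some c)) H.labV j, listAtt_mem _ _ j⟩
      natt_lab := fun b => match b with
        | true => fun j => listAtt_lab _ _ j
        | false => fun j => listAtt_lab _ _ j
      tlab := Empty.elim
      tatt := fun e => e.elim
      tatt_lab := fun e => e.elim
      ext := fun j => ⟨listAtt (C.bdList (some c)) H.labV j, listAtt_mem _ _ j⟩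
      ext_lab := fun j => listAtt_lab _ _ j }
  | .halt c =>
    { V := {v : H.V // v ∈ C.bdList (some c)}
      I := Empty
      T := Empty
      finite_V := inferInstance
      finite_I := inferInstance
      finite_T := inferInstance
      labV := fun v => H.labV v
      nlab := Empty.elim
      natt := fun e => e.elim
      natt_lab := fun e => e.elim
      tlab := Empty.elim
      tatt := fun e => e.elim
      tatt_lab := fun e => e.elim
      ext := fun j => ⟨listAtt (C.bdList (some c)) H.labV j, listAtt_mem _ _ j⟩
      ext_lab := fun j => listAtt_lab _ _ j }

/-- The grammar of a forest of components. -/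
noncomputable def grammar : FGG S :=
  FGG.ofShapes C.ntype GRule.lhs C.shape (.body none) (by simp [ntype, Nonterm.nodes, bdList_none])

/-- Only `iter c` has two rules, and these have two and zero nonterminal edges. -/
theorem grammar_separated : C.grammar.Separated := by
  have hne : ∀ c, (C.shape (.step c)).edgeNames ≠ (C.shape (.halt c)).edgeNames := by
    intro c h
    have := congrArg Finset.card h
    simp [Shape.edgeNames, shape] at this
  rintro (o | c | c) (o' | c' | c') hl he
  · cases (hl : Nonterm.body o = .body o')
    rfl
  · cases (hl : Nonterm.body o = .iter c')
  · cases (hl : Nonterm.body o = .iter c')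
  · cases (hl : Nonterm.iter c = .body o')
  · cases (hl : Nonterm.iter c = .iter c')
    rfl
  · cases (hl : Nonterm.iter c = .iter c')
    exact absurd he (hne c)
  · cases (hl : Nonterm.iter c = .body o')
  · cases (hl : Nonterm.iter c = .iter c')
    exact absurd he.symm (hne c)
  · cases (hl : Nonterm.iter c = .iter c')
    rfl

/-! ### Decomposition of the unrolled graph -/

variable {C} [Finite B] {M : B → ℕ}

variable (C)

/-- The nodes generated by the copy `i` of `o`. -/
def bodyV (o : Option C.I) (i : Idx M (C.PO o)) : Set (H.unroll M).V :=
  {p | (C.Below (some (C.own p.1)) o ∨ p.1 ∈ C.bdO o) ∧ i.Agree p.2}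

/-- The edges generated by the copy `i` of `o`. -/
def bodyE (o : Option C.I) (i : Idx M (C.PO o)) : Set (H.unroll M).E :=
  {p | C.Below (some (C.ownE p.1)) o ∧ i.Agree p.2}

/-- The nodes generated by the copies of `c` in `J`, inside of the copy `i` of its parent. -/
def iterV (c : C.I) (i : Idx M (C.PO (C.parent c))) (J : Set (Idx M (C.P c))) :
    Set (H.unroll M).V :=
  {p | (p.1 ∈ C.bd c ∧ i.Agree p.2) ∨ C.Below (some (C.own p.1)) (some c) ∧ ∃ j ∈ J, j.Agree p.2}

/-- The edges generated by the copies of `c` in `J`. -/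
def iterE (c : C.I) (J : Set (Idx M (C.P c))) : Set (H.unroll M).E :=
  {p | C.Below (some (C.ownE p.1)) (some c) ∧ ∃ j ∈ J, j.Agree p.2}

variable {C}

variable (C M) in
/-- The copies of `o` and its descendants are generated as expected. -/
def BodyGen (o : Option C.I) : Prop :=
  ∀ i : Idx M (C.PO o), C.grammar.Generates (H.unroll M) (.body o) (C.bodyV o i) (C.bodyE o i)
    fun j => copyV i (listAtt (C.bdList o) H.labV j) (listAtt_plate_body j)

variable (C M) in
/-- The sets of copies of `c` that have the same parent are generated as expected. -/
def IterGen (c : C.I) : Prop :=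
  ∀ (i : Idx M (C.PO (C.parent c))) (J : Set (Idx M (C.P c))), (∀ j ∈ J, i.Agree j) →
    C.grammar.Generates (H.unroll M) (.iter c) (C.iterV c i J) (C.iterE c J)
      fun j => copyV i (listAtt (C.bdList (some c)) H.labV j) (listAtt_plate_iter j)

/-- Induction on `J`: `halt` for the empty set and one `step` for each further copy. All copies
share the boundary, whose plates lie in the parent, and are disjoint elsewhere. -/
theorem iterGen_of_bodyGen {c : C.I} (hc : C.BodyGen M (some c)) : C.IterGen M c := by
  intro i J
  have hbd : ∀ v : {v : H.V // v ∈ C.bdList (some c)}, H.plateV v.1 ⊆ C.PO (C.parent c) :=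
    fun v => plateV_subset_PO (mem_bd (mem_bdList.mp v.2) rfl)
  have hJ := Set.toFinite J
  induction J, hJ using Set.Finite.induction_on with
  | empty =>
    intro _
    refine FGG.Generates.shape' (sh := C.shape) (.halt c) (fun v => copyV i v.1 (hbd v)) Empty.elim
      Empty.elim Empty.elim ?_ ?_ ?_ ?_ ?_
    · exact {
        injV := fun v w h => Subtype.ext (copyV_inj h)
        labV := fun v => rfl
        injE := fun e => e.elim
        labE := fun e => e.elim
        att := fun e => e.elim
        inter := fun e => e.elim
        inter' := fun e => e.elim
        disj := fun e => e.elim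
        disj' := fun e => e.elim }
    · exact fun e => e.elim
    · intro w
      constructor
      · rintro (⟨h1, h2⟩ | ⟨-, j, hj, -⟩)
        · exact Or.inl ⟨⟨w.1, mem_bdList.mpr h1⟩, copyV_eq _ h2⟩
        · exact hj.elim
      · rintro (⟨v, rfl⟩ | ⟨e, -⟩)
        · exact Or.inl ⟨mem_bdList.mp v.2, i.agree_res (hbd v)⟩
        · exact e.elim
    · intro d
      constructor
      · rintro ⟨-, j, hj, -⟩
        exact hj.elim
      · rintro (⟨e, -⟩ | ⟨e, -⟩) <;> exact e.elim
    · exact fun j => rfl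
  | @insert k J hk hJ ih =>
    intro hJi
    have hik : i.Agree k := hJi k (Set.mem_insert _ _)
    have hsub : C.PO (C.parent c) ⊆ C.P c := PO_subset_of_parent rfl
    -- An index defined on all plates of `c` agrees with at most one copy of `c`. Nodes and edges
    -- below `c` have such indices.
    have hdis : ∀ {t : Set B} (j : Idx M t), C.P c ⊆ t → k.Agree j → ∀ k' ∈ J, ¬ k'.Agree j := by
      intro t j ht h1 k' hk' h2
      have : k = k' := Idx.Agree.eq fun b hb hb' => (h1 b hb (ht hb)).trans (h2 b hb' (ht hb)).symm
      exact hk (this ▸ hk')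
    refine FGG.Generates.shape' (sh := C.shape) (.step c) (fun v => copyV i v.1 (hbd v)) Empty.elim
      (fun b : Bool => match b with
        | true => C.bodyV (some c) k
        | false => C.iterV c i J)
      (fun b : Bool => match b with
        | true => C.bodyE (some c) k
        | false => C.iterE c J) ?_ ?_ ?_ ?_ ?_
    · exact {
        injV := fun v w h => Subtype.ext (copyV_inj h)
        labV := fun v => rfl
        injE := fun e => e.elim
        labE := fun e => e.elim
        att := fun e => e.elim
        inter := by
          rintro (_ | _) ⟨v, hv⟩ -
          all_goals
            obtain ⟨j, hj⟩ := exists_listAtt H.labV hv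
            exact ⟨j, Subtype.ext hj⟩
        inter' := by
          have key : ∀ w, w ∈ C.bodyV (some c) k → w ∈ C.iterV c i J →
              w ∈ Set.range fun v : {v : H.V // v ∈ C.bdList (some c)} =>
                copyV i v.1 (hbd v) := by
            rintro w ⟨h1, h2⟩ (⟨h3, h4⟩ | ⟨h3, k', hk', h4⟩)
            · exact ⟨⟨w.1, mem_bdList.mpr h3⟩, copyV_eq _ h4⟩
            · exact absurd h4 (hdis w.2 h3.PO_subset_plateV h2 k' hk')
          rintro (_ | _) (_ | _) w he h h'
          · exact absurd rfl he
          · exact key w h' h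
          · exact key w h h'
          · exact absurd rfl he
        disj := fun e => e.elim
        disj' := by
          have key : ∀ d, d ∈ C.bodyE (some c) k → d ∉ C.iterE c J := by
            rintro d ⟨h1, h2⟩ ⟨h3, k', hk', h4⟩
            exact hdis d.2 h3.PO_subset_plateE h2 k' hk' h4
          rintro (_ | _) (_ | _) d he h h'
          · exact absurd rfl he
          · exact key d h' h
          · exact key d h h'
          · exact absurd rfl he }
    · rintro (_ | _)
      · exact ih fun j hj => hJi j (Set.mem_insert_of_mem _ hj)
      · have h := hc k
        have hx : (fun j : Fin (C.ntype (.body (some c))).length =>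
            copyV k (listAtt (C.bdList (some c)) H.labV j) (listAtt_plate_body j)) =
            fun j => copyV i (listAtt (C.bdList (some c)) H.labV j) (listAtt_plate_iter j) :=
          funext fun j => (copyV_congr hik _ _).symm
        exact (congrArg (FGG.Generates C.grammar (H.unroll M) (.body (some c)) _ _) hx).mp h
    · intro w
      constructor
      · rintro (⟨h1, h2⟩ | ⟨h1, j, rfl | hj, h2⟩)
        · exact Or.inl ⟨⟨w.1, mem_bdList.mpr h1⟩, copyV_eq _ h2⟩
        · exact Or.inr ⟨true, Or.inl h1, h2⟩
        · exact Or.inr ⟨false, Or.inr ⟨h1, j, hj, h2⟩⟩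
      · rintro (⟨v, rfl⟩ | ⟨_ | _, h⟩)
        · exact Or.inl ⟨mem_bdList.mp v.2, i.agree_res (hbd v)⟩
        · obtain h | ⟨h1, j, hj, h2⟩ := h
          · exact Or.inl h
          · exact Or.inr ⟨h1, j, Set.mem_insert_of_mem _ hj, h2⟩
        · obtain ⟨h1 | h1, h2⟩ := h
          · exact Or.inr ⟨h1, k, Set.mem_insert _ _, h2⟩
          · exact Or.inl ⟨h1, hik.trans h2 (Set.inter_subset_left.trans hsub)⟩
    · intro d
      constructor
      · rintro ⟨h1, j, rfl | hj, h2⟩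
        · exact Or.inr ⟨true, h1, h2⟩
        · exact Or.inr ⟨false, h1, j, hj, h2⟩
      · rintro (⟨e, -⟩ | ⟨_ | _, h⟩)
        · exact e.elim
        · obtain ⟨h1, j, hj, h2⟩ := h
          exact ⟨h1, j, Set.mem_insert_of_mem _ hj, h2⟩
        · obtain ⟨h1, h2⟩ := h
          exact ⟨h1, k, Set.mem_insert _ _, h2⟩
    · exact fun j => rfl

/-- What lies below `o` is owned by `o` or lies below exactly one child. The copies of a child
inside the copy `i` are those whose index agrees with `i`, which determines the sets `J`. -/
theorem bodyGen_of_iterGen {o : Option C.I} (ho : ∀ c, C.parent c = o → C.IterGen M c) :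
    C.BodyGen M o := by
  intro i
  have hV : ∀ v : {v : H.V // some (C.own v) = o ∨ v ∈ C.bdO o}, H.plateV v.1 ⊆ C.PO o :=
    fun v => plateV_subset_PO v.2
  have hE : ∀ e : {e : H.E // some (C.ownE e) = o}, H.plateE e.1 ⊆ C.PO o := by
    rintro ⟨e, rfl⟩
    exact (C.P_ownE e).symm.subset
  have hpar : ∀ {a : Option C.I} {c : C.I}, C.parent c = o → C.Below a (some c) → C.Below a o :=
    fun hc h => h.trans (hc ▸ below_parent _)
  have hnot : ∀ {v : H.V} {c : C.I}, some (C.own v) = o ∨ v ∈ C.bdO o → C.parent c = o →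
      ¬ C.Below (some (C.own v)) (some c) := by
    rintro v c (rfl | h) hc hb
    · exact not_below_parent c (hc ▸ hb)
    · exact not_below_of_mem_bdO h (hpar hc hb)
  refine FGG.Generates.shape' (sh := C.shape) (.body o) (fun v => copyV i v.1 (hV v))
    (fun e => copyE i e.1 (hE e))
    (fun c => C.iterV c.1 (i.res (congrArg C.PO c.2).subset) {j | i.Agree j})
    (fun c => C.iterE c.1 {j | i.Agree j}) ?_ ?_ ?_ ?_ ?_
  · exact {
      injV := fun v w h => Subtype.ext (copyV_inj h)
      labV := fun v => rfl
      injE := fun v w h => Subtype.ext (copyE_inj h)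
      labE := fun e => rfl
      att := fun e j h h' => rfl
      inter := by
        rintro ⟨c, hc⟩ ⟨v, hv⟩ (⟨h1, -⟩ | ⟨h1, -⟩)
        · obtain ⟨j, hj⟩ := exists_listAtt H.labV (mem_bdList (o := some c) |>.mpr h1)
          exact ⟨j, Subtype.ext hj⟩
        · exact absurd h1 (hnot hv hc)
      inter' := by
        rintro ⟨c, hc⟩ ⟨c', hc'⟩ w he (⟨h1, h2⟩ | ⟨h1, -⟩) (⟨h3, h4⟩ | ⟨h3, -⟩)
        · refine ⟨⟨w.1, mem_bd h1 hc⟩, copyV_eq _ fun b hb hb' => ?_⟩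
          exact h2 b (hc ▸ hb) hb'
        · exact absurd h3 (hnot (mem_bd h1 hc) hc')
        · exact absurd h1 (hnot (mem_bd h3 hc') hc)
        · exact absurd (Subtype.ext (h1.unique h3 (hc.trans hc'.symm))) he
      disj := by
        rintro ⟨e, rfl⟩ ⟨c, hc⟩ ⟨h1, -⟩
        exact not_below_parent c (hc ▸ h1)
      disj' := by
        rintro ⟨c, hc⟩ ⟨c', hc'⟩ d he ⟨h1, -⟩ ⟨h2, -⟩
        exact he (Subtype.ext (h1.unique h2 (hc.trans hc'.symm))) }
  · rintro ⟨c, rfl⟩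
    exact ho c rfl i {j | i.Agree j} fun j hj => hj
  · intro w
    constructor
    · rintro ⟨h1 | h1, h2⟩
      -- Either `w` is owned by `o`, or its chain of ancestors enters `o` from a child `c`; the
      -- relevant copy of `c` is the restriction of the index of `w` to `C.P c`.
      · rcases Relation.ReflTransGen.cases_tail h1 with h | ⟨_, h, c, rfl, hc⟩
        · exact Or.inl ⟨⟨w.1, Or.inl h.symm⟩, copyV_eq _ h2⟩
        · have hs : C.P c ⊆ H.plateV w.1 := Below.PO_subset_plateV h
          refine Or.inr ⟨⟨c, hc⟩, Or.inr ⟨h, Idx.res w.2 hs, ?_, Idx.res_agree w.2 hs⟩⟩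
          exact h2.trans (Idx.agree_res w.2 hs) (Set.inter_subset_right.trans hs)
      · exact Or.inl ⟨⟨w.1, Or.inr h1⟩, copyV_eq _ h2⟩
    · rintro (⟨v, rfl⟩ | ⟨⟨c, hc⟩, ⟨h1, h2⟩ | ⟨h1, j, hj, h2⟩⟩)
      · refine ⟨?_, i.agree_res (hV v)⟩
        obtain ⟨v, h | h⟩ := v
        · exact Or.inl (Below.of_eq h)
        · exact Or.inr h
      · refine ⟨?_, fun b hb hb' => h2 b (hc ▸ hb) hb'⟩
        rcases mem_bd h1 hc with h | h
        · exact Or.inl (Below.of_eq h)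
        · exact Or.inr h
      · exact ⟨Or.inl (hpar hc h1),
          hj.trans h2 (Set.inter_subset_left.trans (PO_subset_of_parent hc))⟩
  · intro w
    constructor
    · rintro ⟨h1, h2⟩
      rcases Relation.ReflTransGen.cases_tail h1 with h | ⟨_, h, c, rfl, hc⟩
      · exact Or.inl ⟨⟨w.1, h.symm⟩, copyE_eq _ h2⟩
      · have hs : C.P c ⊆ H.plateE w.1 := Below.PO_subset_plateE h
        refine Or.inr ⟨⟨c, hc⟩, h, Idx.res w.2 hs, ?_, Idx.res_agree w.2 hs⟩
        exact h2.trans (Idx.agree_res w.2 hs) (Set.inter_subset_right.trans hs)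
    · rintro (⟨v, rfl⟩ | ⟨⟨c, hc⟩, h1, j, hj, h2⟩)
      · refine ⟨?_, i.agree_res (hE v)⟩
        obtain ⟨v, h⟩ := v
        exact Below.of_eq h
      · exact ⟨hpar hc h1,
          hj.trans h2 (Set.inter_subset_left.trans (PO_subset_of_parent hc))⟩
  · exact fun j => rfl

/-- Children have strictly larger plate sets, of which there are finitely many, so the induction
runs from the leaves upwards. -/
theorem bodyGen_some (c : C.I) : C.BodyGen M (some c) := by
  have : WellFounded fun c c' : C.I => C.P c > C.P c' := InvImage.wf C.P wellFounded_gt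
  induction c using this.induction with
  | _ c ih => exact bodyGen_of_iterGen fun c' hc' => iterGen_of_bodyGen (ih c' (C.parent_lt c' c hc'))

variable (C M) in
theorem exists_control : ∃ GM : FGG S,
    GM.FactorFree ∧ (C.grammar.conj GM).GeneratesExactly (H.unroll M) := by
  have h : C.BodyGen M none := bodyGen_of_iterGen fun c _ => iterGen_of_bodyGen (bodyGen_some c)
  -- The whole graph has no plates, hence a single copy.
  have i : Idx M (C.PO none) := fun b => b.2.elim
  have hi : ∀ (t : Set B) (j : Idx M t), i.Agree j := fun t j b hb => hb.elim
  have h1 : C.bodyV none i = Set.univ :=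
    Set.eq_univ_of_forall fun p => ⟨Or.inl (below_none _), hi _ _⟩
  have h2 : C.bodyE none i = Set.univ :=
    Set.eq_univ_of_forall fun p => ⟨below_none _, hi _ _⟩
  have h' := h i
  rw [h1, h2] at h'
  exact FGG.Generates.exists_control C.grammar_separated h'

end Grammar

end PlateForest

theorem PFG.exists_grammar {S : Signature.{u}} {B : Type} [Finite B] (H : PFG S B)
    (h : H.toPlatedGraph.Succeeds) :
    ∃ G : FGG S, ∀ M : B → ℕ, ∃ GM : FGG S,
      GM.FactorFree ∧ (G.conj GM).GeneratesExactly (H.unroll M) := by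
  have := H.finite_V
  have := H.finite_E
  obtain ⟨C⟩ := h.forest H.finite_V H.finite_E (by
    rintro _ e ⟨i, rfl⟩
    exact H.plate_sub e i)
  exact ⟨PlateForest.grammar C, PlateForest.exists_control C⟩

namespace DGM

/-! ## The grammar of a dynamic graphical model -/

/-- The nonterminals: `rest` generates everything that follows a given copy of the second graph. -/
inductive Nonterm
  | start
  | rest

/-- The rules. -/
inductive GRule
  | first
  | step
  | last

instance : Finite Nonterm :=
  Finite.of_surjective (fun b : Bool => if b then Nonterm.start else .rest) (by
    rintro (_ | _)
    · exact ⟨true, rfl⟩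
    · exact ⟨false, rfl⟩)

instance : Finite GRule :=
  Finite.of_surjective
    (fun b : Option Bool => match b with
      | none => GRule.first
      | some true => .step
      | some false => .last) (by
    rintro (_ | _ | _)
    · exact ⟨none, rfl⟩
    · exact ⟨some true, rfl⟩
    · exact ⟨some false, rfl⟩)

/-- The left-hand side of a rule. -/
def GRule.lhs : GRule → Nonterm
  | .first => .start
  | .step => .rest
  | .last => .rest

variable {S : Signature.{u}} (D : DGM S)

/-- The nodes of the second graph. -/
noncomputable def nodeList : List D.H₂.V :=
  have := D.H₂.finite_V
  (Set.toFinite (Set.univ : Set D.H₂.V)).toFinset.toList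

theorem mem_nodeList (v : D.H₂.V) : v ∈ D.nodeList := by
  simp [nodeList]

/-- The type of a nonterminal. -/
noncomputable def ntype : Nonterm → List S.NodeLabel
  | .start => []
  | .rest => D.nodeList.map D.H₂.labV

/-- The right-hand sides. -/
noncomputable def shape : (r : GRule) → Shape S Nonterm D.ntype (D.ntype r.lhs)
  | .first =>
    { V := D.H₁.V ⊕ D.H₂.V
      I := Unit
      T := D.H₁.E ⊕ D.H₂.E ⊕ D.E₁₂
      finite_V := by
        have := D.H₁.finite_V
        have := D.H₂.finite_V
        infer_instance
      finite_I := inferInstance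
      finite_T := by
        have := D.H₁.finite_E
        have := D.H₂.finite_E
        have := D.H₁.finite_V
        have := D.H₂.finite_V
        infer_instance
      labV := Sum.elim D.H₁.labV D.H₂.labV
      nlab := fun _ => .rest
      natt := fun _ j => .inr (listAtt D.nodeList D.H₂.labV j)
      natt_lab := fun _ j => listAtt_lab D.nodeList D.H₂.labV j
      tlab := Sum.elim D.H₁.labE (Sum.elim D.H₂.labE D.lab₁₂)
      tatt := fun t => match t with
        | .inl e => fun j => .inl (D.H₁.att e j)
        | .inr (.inl e) => fun j => .inr (D.H₂.att e j)
        | .inr (.inr p) => pairAtt (.inl p.1.1) (.inr p.1.2) _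
      tatt_lab := by
        rintro (e | e | p) j
        · exact D.H₁.att_lab e j
        · exact D.H₂.att_lab e j
        · exact pairAtt_lab (V := D.H₁.V ⊕ D.H₂.V) (Sum.elim D.H₁.labV D.H₂.labV) _ _ _
            (D.type₁₂ p) j
      ext := fun j => j.elim0
      ext_lab := fun j => j.elim0 }
  | .step =>
    { V := D.H₂.V ⊕ D.H₂.V
      I := Unit
      T := D.H₂.E ⊕ D.E₂₂
      finite_V := by
        have := D.H₂.finite_V
        infer_instance
      finite_I := inferInstance
      finite_T := by
        have := D.H₂.finite_E
        have := D.H₂.finite_V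
        infer_instance
      labV := Sum.elim D.H₂.labV D.H₂.labV
      nlab := fun _ => .rest
      natt := fun _ j => .inr (listAtt D.nodeList D.H₂.labV j)
      natt_lab := fun _ j => listAtt_lab D.nodeList D.H₂.labV j
      tlab := Sum.elim D.H₂.labE D.lab₂₂
      tatt := fun t => match t with
        | .inl e => fun j => .inr (D.H₂.att e j)
        | .inr p => pairAtt (.inl p.1.1) (.inr p.1.2) _
      tatt_lab := by
        rintro (e | p) j
        · exact D.H₂.att_lab e j
        · exact pairAtt_lab (V := D.H₂.V ⊕ D.H₂.V) (Sum.elim D.H₂.labV D.H₂.labV) _ _ _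
            (D.type₂₂ p) j
      ext := fun j => .inl (listAtt D.nodeList D.H₂.labV j)
      ext_lab := fun j => listAtt_lab D.nodeList D.H₂.labV j }
  | .last =>
    { V := D.H₂.V ⊕ D.H₃.V
      I := Empty
      T := D.H₃.E ⊕ D.E₂₃
      finite_V := by
        have := D.H₂.finite_V
        have := D.H₃.finite_V
        infer_instance
      finite_I := inferInstance
      finite_T := by
        have := D.H₃.finite_E
        have := D.H₂.finite_V
        have := D.H₃.finite_V
        infer_instance
      labV := Sum.elim D.H₂.labV D.H₃.labV
      nlab := Empty.elim
      natt := fun e => e.elim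
      natt_lab := fun e => e.elim
      tlab := Sum.elim D.H₃.labE D.lab₂₃
      tatt := fun t => match t with
        | .inl e => fun j => .inr (D.H₃.att e j)
        | .inr p => pairAtt (.inl p.1.1) (.inr p.1.2) _
      tatt_lab := by
        rintro (e | p) j
        · exact D.H₃.att_lab e j
        · exact pairAtt_lab (V := D.H₂.V ⊕ D.H₃.V) (Sum.elim D.H₂.labV D.H₃.labV) _ _ _
            (D.type₂₃ p) j
      ext := fun j => .inl (listAtt D.nodeList D.H₂.labV j)
      ext_lab := fun j => listAtt_lab D.nodeList D.H₂.labV j }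

/-- The grammar of a dynamic graphical model. -/
noncomputable def grammar : FGG S :=
  FGG.ofShapes D.ntype GRule.lhs D.shape .start rfl

/-- `step` has one nonterminal edge and `last` has none. -/
theorem grammar_separated : D.grammar.Separated := by
  have hne : (D.shape .step).edgeNames ≠ (D.shape .last).edgeNames := by
    intro h
    have := congrArg Finset.card h
    simp [Shape.edgeNames, shape] at this
  rintro (_ | _ | _) (_ | _ | _) hl he
  · rfl
  · cases (hl : Nonterm.start = .rest)
  · cases (hl : Nonterm.start = .rest)
  · cases (hl : Nonterm.rest = .start)
  · rfl
  · exact absurd he hne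
  · cases (hl : Nonterm.rest = .start)
  · exact absurd he.symm hne
  · rfl

/-! ### Decomposition of the unrolled graph -/

variable {n : ℕ} (hn : 2 ≤ n)

/-- The nodes from copy `k` on. -/
def restV (k : ℕ) : Set (D.unroll n hn).V :=
  {p | match p with
    | .inl _ => False
    | .inr (.inl (_, i)) => k ≤ i
    | .inr (.inr _) => True}

/-- The edges that are generated after copy `k`. -/
def restE (k : ℕ) : Set (D.unroll n hn).E :=
  {p | match p with
    | .inl (.inl _) => False
    | .inl (.inr (.inl (_, i))) => k < i
    | .inl (.inr (.inr _)) => True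
    | .inr (.inl _) => False
    | .inr (.inr (.inl (_, i))) => k ≤ i
    | .inr (.inr (.inr _)) => True}

/-- Everything from copy `k` on is generated as expected. -/
def RestGen (k : ℕ) (hk : k < n) : Prop :=
  D.grammar.Generates (D.unroll n hn) .rest (D.restV hn k) (D.restE hn k)
    fun j => .inr (.inl (listAtt D.nodeList D.H₂.labV j, ⟨k, hk⟩))

/-- The edges inside the last copy come from the preceding rule; only `H₃` and the factors leading
to it are new. -/
theorem restGen_last (hk : n - 1 < n) : D.RestGen hn (n - 1) hk := by
  refine FGG.Generates.shape' (U := D.unroll n hn) (sh := D.shape) .last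
    (Sum.elim (fun v => Sum.inr (Sum.inl (v, ⟨n - 1, hk⟩))) fun v => Sum.inr (Sum.inr v))
    (Sum.elim (fun e => Sum.inl (Sum.inr (Sum.inr e))) fun p => Sum.inr (Sum.inr (Sum.inr p)))
    Empty.elim Empty.elim ?_ ?_ ?_ ?_ ?_
  · exact {
      injV := by
        rintro (v | v) (w | w) h <;> cases h <;> rfl
      labV := by
        rintro (v | v) <;> rfl
      injE := by
        rintro (v | v) (w | w) h <;> cases h <;> rfl
      labE := by
        rintro (v | v) <;> rfl
      att := by
        rintro (e | p) i h h'
        · rfl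
        · cases i <;> rfl
      inter := fun e => e.elim
      inter' := fun e => e.elim
      disj := fun _ e => e.elim
      disj' := fun e => e.elim }
  · exact fun e => e.elim
  · rintro (v | ⟨v, i⟩ | v)
    · constructor
      · exact False.elim
      · rintro (⟨_ | _, h⟩ | ⟨e, -⟩)
        · cases h
        · cases h
        · exact e.elim
    · constructor
      · intro (h : n - 1 ≤ i)
        have : (⟨n - 1, hk⟩ : Fin n) = i := Fin.ext (by simp; omega)
        subst this
        exact Or.inl ⟨.inl v, rfl⟩
      · rintro (⟨_ | _, h⟩ | ⟨e, -⟩)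
        · cases h
          exact Nat.le_refl _
        · cases h
        · exact e.elim
    · exact ⟨fun _ => Or.inl ⟨.inr v, rfl⟩, fun _ => trivial⟩
  · rintro ((e | ⟨e, i⟩ | e) | (p | ⟨p, i⟩ | p))
    · constructor
      · exact False.elim
      · rintro (⟨_ | _, h⟩ | ⟨e, -⟩)
        · cases h
        · cases h
        · exact e.elim
    · constructor
      · intro (h : n - 1 < i)
        omega
      · rintro (⟨_ | _, h⟩ | ⟨e, -⟩)
        · cases h
        · cases h
        · exact e.elim
    · exact ⟨fun _ => Or.inl ⟨.inl e, rfl⟩, fun _ => trivial⟩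
    · constructor
      · exact False.elim
      · rintro (⟨_ | _, h⟩ | ⟨e, -⟩)
        · cases h
        · cases h
        · exact e.elim
    · constructor
      · intro (h : n - 1 ≤ i)
        omega
      · rintro (⟨_ | _, h⟩ | ⟨e, -⟩)
        · cases h
        · cases h
        · exact e.elim
    · exact ⟨fun _ => Or.inl ⟨.inr p, rfl⟩, fun _ => trivial⟩
  · exact fun j => rfl

/-- `step` adds copy `k + 1` with its edges and the factors from copy `k` to it. Copy `k` enters
only through its nodes, as external nodes; hence `k ≤ i` for nodes in `restV` but `k < i` for edges
of `H₂` in `restE`. -/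
theorem restGen_step {k : ℕ} (hk : k + 1 < n) (h : D.RestGen hn (k + 1) hk) :
    D.RestGen hn k (by omega) := by
  have hk₁ : k < n := Nat.lt_of_succ_lt hk
  have hk₂ : k < n - 1 := by omega
  refine FGG.Generates.shape' (U := D.unroll n hn) (sh := D.shape) .step
    (Sum.elim (fun v => Sum.inr (Sum.inl (v, ⟨k, by omega⟩))) fun v => Sum.inr (Sum.inl (v, ⟨k + 1, hk⟩)))
    (Sum.elim (fun e => Sum.inl (Sum.inr (Sum.inl (e, ⟨k + 1, hk⟩))))
      fun p => Sum.inr (Sum.inr (Sum.inl (p, ⟨k, by omega⟩))))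
    (fun _ => D.restV hn (k + 1)) (fun _ => D.restE hn (k + 1)) ?_ ?_ ?_ ?_ ?_
  · exact {
      injV := by
        rintro (v | v) (w | w) h
        · cases h
          rfl
        · injection h with h
          injection h with h
          injection h with _ h
          injection h with h
          omega
        · injection h with h
          injection h with h
          injection h with _ h
          injection h with h
          omega
        · cases h
          rfl
      labV := by
        rintro (v | v) <;> rfl
      injE := by
        rintro (v | v) (w | w) h <;> cases h <;> rfl
      labE := by
        rintro (v | v) <;> rfl
      att := by
        rintro (e | p) i h h'
        · rfl
        · cases i <;> rfl
      inter := by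
        rintro _ (v | v) h
        · exact absurd h (Nat.not_succ_le_self k)
        · obtain ⟨j, hj⟩ := exists_listAtt D.H₂.labV (D.mem_nodeList v)
          exact ⟨j, congrArg Sum.inr hj⟩
      inter' := fun e e' _ h => absurd rfl h
      disj := by
        rintro (e | p) _ h
        · exact absurd h (lt_irrefl (k + 1))
        · exact absurd h (Nat.not_succ_le_self k)
      disj' := fun e e' _ h => absurd rfl h }
  · exact fun _ => h
  · rintro (v | ⟨v, i⟩ | v)
    · constructor
      · exact False.elim
      · rintro (⟨_ | _, h⟩ | ⟨e, h⟩)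
        · cases h
        · cases h
        · exact h
    · constructor
      · intro (h : k ≤ i)
        rcases h.eq_or_lt with h | h
        · obtain rfl : i = ⟨k, hk₁⟩ := Fin.ext h.symm
          exact Or.inl ⟨.inl v, rfl⟩
        · exact Or.inr ⟨(), h⟩
      · rintro (⟨_ | _, h⟩ | ⟨e, h⟩)
        · cases h
          exact Nat.le_refl _
        · cases h
          exact Nat.le_succ k
        · exact (Nat.le_succ k).trans h
    · exact ⟨fun _ => Or.inr ⟨(), trivial⟩, fun _ => trivial⟩
  · rintro ((e | ⟨e, i⟩ | e) | (p | ⟨p, i⟩ | p))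
    · constructor
      · exact False.elim
      · rintro (⟨_ | _, h⟩ | ⟨e, h⟩)
        · cases h
        · cases h
        · exact h
    · constructor
      · intro (h : k + 1 ≤ i)
        rcases h.eq_or_lt with h | h
        · obtain rfl : i = ⟨k + 1, hk⟩ := Fin.ext h.symm
          exact Or.inl ⟨.inl e, rfl⟩
        · exact Or.inr ⟨(), h⟩
      · rintro (⟨_ | _, h⟩ | ⟨e, h⟩)
        · cases h
          exact Nat.lt_succ_self k
        · cases h
        · exact (Nat.lt_succ_self k).trans h
    · exact ⟨fun _ => Or.inr ⟨(), trivial⟩, fun _ => trivial⟩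
    · constructor
      · exact False.elim
      · rintro (⟨_ | _, h⟩ | ⟨e, h⟩)
        · cases h
        · cases h
        · exact h
    · constructor
      · intro (h : k ≤ i)
        rcases h.eq_or_lt with h | h
        · obtain rfl : i = ⟨k, hk₂⟩ := Fin.ext h.symm
          exact Or.inl ⟨.inr p, rfl⟩
        · exact Or.inr ⟨(), h⟩
      · rintro (⟨_ | _, h⟩ | ⟨e, h⟩)
        · cases h
        · cases h
          exact Nat.le_refl _
        · exact (Nat.le_succ k).trans h
    · exact ⟨fun _ => Or.inr ⟨(), trivial⟩, fun _ => trivial⟩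
  · exact fun j => rfl

theorem restGen_zero : D.RestGen hn 0 (by omega) := by
  -- `m` is the number of transitions that follow copy `k`.
  have key : ∀ m k (h : k + m + 1 = n), D.RestGen hn k (by omega) := by
    intro m
    induction m with
    | zero =>
      intro k h
      obtain rfl : k = n - 1 := by omega
      exact D.restGen_last hn _
    | succ m ih =>
      intro k h
      exact D.restGen_step hn (by omega) (ih (k + 1) (by omega))
  exact key (n - 1) 0 (by omega)

theorem generates_unroll :
    D.grammar.Generates (D.unroll n hn) .start Set.univ Set.univ fun j => j.elim0 := by
  have hn₀ : 0 < n := by omega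
  refine FGG.Generates.shape' (U := D.unroll n hn) (sh := D.shape) .first
    (Sum.elim (fun v => Sum.inl v) fun v => Sum.inr (Sum.inl (v, ⟨0, by omega⟩)))
    (Sum.elim (fun e => Sum.inl (Sum.inl e)) (Sum.elim (fun e => Sum.inl (Sum.inr (Sum.inl (e, ⟨0, by omega⟩))))
      fun p => Sum.inr (Sum.inl p)))
    (fun _ => D.restV hn 0) (fun _ => D.restE hn 0) ?_ ?_ ?_ ?_ ?_
  · exact {
      injV := by
        rintro (v | v) (w | w) h <;> cases h <;> rfl
      labV := by
        rintro (v | v) <;> rfl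
      injE := by
        rintro (v | v | v) (w | w | w) h <;> cases h <;> rfl
      labE := by
        rintro (v | v | v) <;> rfl
      att := by
        rintro (e | e | p) i h h'
        · rfl
        · rfl
        · cases i <;> rfl
      inter := by
        rintro _ (v | v) h
        · exact h.elim
        · obtain ⟨j, hj⟩ := exists_listAtt D.H₂.labV (D.mem_nodeList v)
          exact ⟨j, congrArg Sum.inr hj⟩
      inter' := fun e e' _ h => absurd rfl h
      disj := by
        rintro (e | e | p) _ h
        · exact h.elim
        · exact absurd h (lt_irrefl 0)
        · exact h.elim
      disj' := fun e e' _ h => absurd rfl h }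
  · exact fun _ => D.restGen_zero hn
  · rintro (v | ⟨v, i⟩ | v)
    · exact ⟨fun _ => Or.inl ⟨.inl v, rfl⟩, fun _ => trivial⟩
    · exact ⟨fun _ => Or.inr ⟨(), Nat.zero_le _⟩, fun _ => trivial⟩
    · exact ⟨fun _ => Or.inr ⟨(), trivial⟩, fun _ => trivial⟩
  · rintro ((e | ⟨e, i⟩ | e) | (p | ⟨p, i⟩ | p))
    · exact ⟨fun _ => Or.inl ⟨.inl e, rfl⟩, fun _ => trivial⟩
    · refine ⟨fun _ => ?_, fun _ => trivial⟩
      rcases Nat.eq_zero_or_pos i with h | h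
      · obtain rfl : i = ⟨0, hn₀⟩ := Fin.ext h
        exact Or.inl ⟨.inr (.inl e), rfl⟩
      · exact Or.inr ⟨(), h⟩
    · exact ⟨fun _ => Or.inr ⟨(), trivial⟩, fun _ => trivial⟩
    · exact ⟨fun _ => Or.inl ⟨.inr (.inr p), rfl⟩, fun _ => trivial⟩
    · exact ⟨fun _ => Or.inr ⟨(), Nat.zero_le _⟩, fun _ => trivial⟩
    · exact ⟨fun _ => Or.inr ⟨(), trivial⟩, fun _ => trivial⟩
  · exact fun j => j.elim0

theorem exists_grammar : ∃ G : FGG S, ∀ (n : ℕ) (hn : 2 ≤ n), ∃ Gn : FGG S,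
    Gn.FactorFree ∧ (G.conj Gn).GeneratesExactly (D.unroll n hn) :=
  ⟨D.grammar, fun _ hn =>
    FGG.Generates.exists_control D.grammar_separated (D.generates_unroll hn)⟩

end DGM

/-! ## Sum–products of grammars without external nodes -/

/-- A product of sums is a sum of products. -/
theorem ENNReal.tsum_pi_prod {ι : Type} [Fintype ι] :
    ∀ (α : ι → Type) (g : (i : ι) → α i → ℝ≥0∞),
      ∑' f : (i : ι) → α i, ∏ i, g i (f i) = ∏ i, ∑' a, g i a := by
  refine Fintype.induction_empty_option (P := fun ι _ => ∀ (α : ι → Type)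
    (g : (i : ι) → α i → ℝ≥0∞), ∑' f : (i : ι) → α i, ∏ i, g i (f i) = ∏ i, ∑' a, g i a)
    ?_ ?_ ?_ ι
  · intro ι κ _ e ih α g
    let _ := Fintype.ofEquiv κ e.symm
    rw [← (e.prod_comp fun i => ∑' a, g i a), ← (Equiv.piCongrLeft α e).tsum_eq, ← ih]
    refine tsum_congr fun f => ?_
    rw [← e.prod_comp]
    simp
  · intro α g
    simp [tsum_fintype]
  · intro ι _ ih α g
    rw [← Equiv.piOptionEquivProd.symm.tsum_eq, ENNReal.tsum_prod', Fintype.prod_option, ← ih,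
      ← ENNReal.tsum_mul_right]
    refine tsum_congr fun a => ?_
    rw [← ENNReal.tsum_mul_left]
    refine tsum_congr fun f => ?_
    rw [Fintype.prod_option]
    rfl

section BoolSums

variable {X T : Type} [Finite X] [Finite T] {type : T → List X}
  {F : (t : T) → (Fin (type t).length → Bool) → ℝ≥0}

/-- The sum of the weights of all assignments. -/
noncomputable def FactorGraph.total (U : FactorGraph (boolSignature X T type F)) : ℝ≥0∞ :=
  ∑' ξ : U.V → Bool, ((∏ᶠ e : U.E, F (U.labE e) fun i => ξ (U.att e i) : ℝ≥0) : ℝ≥0∞)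

variable {N : Type} {ntype : N → List X} {ℓ : List X}

/-- The sum over all assignments to the nodes of a right-hand side of the product of its factors. -/
noncomputable def RHS.nodeSum (R : RHS (boolSignature X T type F) N ntype ℓ) : ℝ≥0∞ :=
  ∑' ξ : R.nodes → Bool, ((∏ᶠ e : R.TEdge, F (R.tlab e) fun i => ξ (R.tatt e i) : ℝ≥0) : ℝ≥0∞)

theorem ENNReal.coe_finprod {ι : Type} [Fintype ι] (f : ι → ℝ≥0) :
    ((∏ᶠ i, f i : ℝ≥0) : ℝ≥0∞) = ∏ i, (f i : ℝ≥0∞) := by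
  rw [finprod_eq_prod_of_fintype, ENNReal.ofNNReal_finsetProd]

/-- With empty types nothing is identified: an assignment of the glued graph is an independent
choice for each part, and its weight is the product of theirs. -/
theorem total_glue (R : RHS (boolSignature X T type F) N ntype ℓ) (hR : ∀ Y, ntype Y = [])
    (H : (e : R.nedges) → Fragment (boolSignature X T type F) (ntype (R.nlab e))) :
    (glue R H).total = R.nodeSum * ∏ e, (H e).total := by
  have := R.finite_TEdge
  have : ∀ e, Finite (H e).E := fun e => (H e).finite_E
  have := Fintype.ofFinite R.TEdge
  have := fun e => Fintype.ofFinite (H e).E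
  have hq : Function.Bijective (Quot.mk (GlueRel R H)) := by
    refine ⟨fun a b hab => ?_, Quot.mk_surjective⟩
    refine congrArg (Quot.lift id ?_) hab
    rintro _ _ ⟨e, j⟩
    rw [hR] at j
    exact j.elim0
  let eq : ((R.nodes → Bool) × ((e : R.nedges) → (H e).V → Bool)) ≃
      (Quot (GlueRel R H) → Bool) :=
    (((Equiv.refl _).prodCongr (Equiv.piCurry fun _ _ => Bool).symm).trans
      (Equiv.sumArrowEquivProdArrow _ _ _).symm).trans
      (Equiv.arrowCongr (Equiv.ofBijective _ hq) (Equiv.refl _))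
  have heq : ∀ p v, eq p (Quot.mk _ v) = Sum.elim p.1 (fun x => p.2 x.1 x.2) v := by
    intro p v
    have : (Equiv.ofBijective _ hq).symm (Quot.mk _ v) = v :=
      (Equiv.ofBijective _ hq).symm_apply_apply v
    simp only [eq, Equiv.trans_apply, Equiv.arrowCongr_apply, Function.comp_apply, this]
    cases v <;> rfl
  have h1 : (glue R H).total = ∑' p, ((∏ᶠ e : (glue R H).E, F ((glue R H).labE e)
      fun i => eq p ((glue R H).att e i) : ℝ≥0) : ℝ≥0∞) := (eq.tsum_eq _).symm
  rw [h1, ENNReal.tsum_prod']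
  simp only [RHS.nodeSum, FactorGraph.total]
  rw [← ENNReal.tsum_pi_prod, ← ENNReal.tsum_mul_right]
  refine tsum_congr fun a => ?_
  rw [← ENNReal.tsum_mul_left]
  refine tsum_congr fun b => ?_
  have h2 := ENNReal.coe_finprod (ι := R.TEdge ⊕ (Σ e, (H e).E))
    fun e => F ((glue R H).labE e) fun i => eq (a, b) ((glue R H).att e i)
  refine h2.trans ?_
  rw [Fintype.prod_sum_type, Fintype.prod_sigma, ENNReal.coe_finprod]
  congr 1
  · refine Finset.prod_congr rfl fun e _ => ?_
    congr 2
    funext i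
    exact heq _ _
  · refine Finset.prod_congr rfl fun e _ => ?_
    rw [ENNReal.coe_finprod]
    refine Finset.prod_congr rfl fun t _ => ?_
    congr 2
    funext i
    exact heq _ _

namespace FGG

/-- The sum–product of a nonterminal. -/
noncomputable def derivationSum (K : FGG (boolSignature X T type F)) (Y : K.N) : ℝ≥0∞ :=
  ∑' d : K.Derivation Y, d.derived.total

/-- A derivation consists of a rule and derivations of its nonterminals. -/
def derivationEquiv {S : Signature.{u}} (K : FGG S) (Y : K.N) :
    K.Derivation Y ≃
      Σ r : {r // K.lhs r = Y}, ((e : (K.rhs r.1).nedges) → K.Derivation ((K.rhs r.1).nlab e)) where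
  toFun := fun d => match d with
    | .mk r kids => ⟨⟨r, rfl⟩, kids⟩
  invFun := fun p => match p with
    | ⟨⟨r, h⟩, kids⟩ => h ▸ .mk r kids
  left_inv := by
    rintro ⟨r, kids⟩
    rfl
  right_inv := by
    rintro ⟨⟨r, rfl⟩, kids⟩
    rfl

/-- Distributivity turns the sum over tuples of subtrees into a product of sums. -/
theorem derivationSum_eq (K : FGG (boolSignature X T type F)) (hK : ∀ Y, K.ntype Y = [])
    (Y : K.N) : K.derivationSum Y = ∑' r : {r // K.lhs r = Y},
      (K.rhs r.1).nodeSum * ∏ e, K.derivationSum ((K.rhs r.1).nlab e) := by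
  unfold derivationSum
  rw [← (K.derivationEquiv Y).symm.tsum_eq, ENNReal.tsum_sigma']
  refine tsum_congr ?_
  rintro ⟨r, rfl⟩
  rw [← ENNReal.tsum_pi_prod, ← ENNReal.tsum_mul_left]
  exact tsum_congr fun kids => total_glue (K.rhs r) hK fun e => (kids e).derived

end FGG

end BoolSums

/-! ## Grammars of decision diagrams -/

/-- A rule of a decision diagram with nodes `V` over the Boolean variables `X`: it may fix the value
of a variable, it has a coefficient and a list of children. -/
structure DiagramRule (X V : Type) where
  lit : Option (X × Bool)
  coef : ℝ≥0
  kids : List V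

/-- A decision diagram: every node has at most two rules, indexed by the Boolean values. -/
structure Diagram (X V : Type) where
  rule : V → Bool → Option (DiagramRule X V)
  kids_le : ∀ v b r, rule v b = some r → r.kids.length ≤ 2
  kids_ne : ∀ v r r', rule v true = some r → rule v false = some r' → r.kids ≠ []
  wf : WellFounded fun w v => ∃ b r, rule v b = some r ∧ w ∈ r.kids

namespace Diagram

variable {X V : Type} (ρ : Diagram X V)

/-- The terminal labels: indicators of literals, and coefficients of rules. -/
abbrev Term (X V : Type) : Type := (X × Bool) ⊕ (V × Bool)

/-- The types of the terminal labels. -/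
def type : Term X V → List X
  | .inl y => [y.1]
  | .inr _ => []

/-- The functions attached to the terminal labels. -/
def fn : (t : Term X V) → (Fin (type t).length → Bool) → ℝ≥0
  | .inl y => fun a => if a ⟨0, Nat.one_pos⟩ = y.2 then 1 else 0
  | .inr p => fun _ => (ρ.rule p.1 p.2).elim 0 DiagramRule.coef

/-- The indices of the rules. -/
abbrev GRule : Type := {p : V × Bool // (ρ.rule p.1 p.2).isSome}

variable {ρ}

/-- The rule with a given index. -/
def GRule.rule (p : ρ.GRule) : DiagramRule X V := (ρ.rule p.1.1 p.1.2).get p.2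

theorem GRule.rule_eq (p : ρ.GRule) : ρ.rule p.1.1 p.1.2 = some p.rule := (Option.some_get p.2).symm

/-- The literal of a rule, as a type with at most one element. -/
abbrev GRule.Lit (p : ρ.GRule) : Type := {y : X × Bool // p.rule.lit = some y}

instance (p : ρ.GRule) : Subsingleton p.Lit :=
  ⟨fun y z => Subtype.ext (Option.some.inj (y.2.symm.trans z.2))⟩

variable (ρ) [Finite V]

theorem card_rule_le : Nat.card ρ.GRule ≤ 2 * Nat.card V := by
  refine (Finite.card_subtype_le _).trans ?_
  simp [mul_comm]

variable [Finite X]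

/-- The signature of a decision diagram. -/
abbrev signature : Signature.{0} := boolSignature X (Term X V) type ρ.fn

variable {ρ}

/-- The right-hand side of a rule, with arbitrary terminal edges. -/
def GRule.shape (p : ρ.GRule) (T : Type) [Finite T] (tlab : T → Term X V)
    (tatt : (e : T) → Fin (type (tlab e)).length → p.Lit)
    (tatt_lab : ∀ e i, (tatt e i).1.1 = (type (tlab e)).get i) :
    Shape ρ.signature V (fun _ => []) [] where
  V := p.Lit
  I := Fin p.rule.kids.length
  T := T
  finite_V := inferInstance
  finite_I := inferInstance
  finite_T := inferInstance
  labV := fun y => y.1.1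
  nlab := p.rule.kids.get
  natt := fun _ j => j.elim0
  natt_lab := fun _ j => j.elim0
  tlab := tlab
  tatt := tatt
  tatt_lab := tatt_lab
  ext := fun j => j.elim0
  ext_lab := fun j => j.elim0
  -- Starting the edge names at 0 or at 1 keeps the two rules of a node from being conjoined with
  -- each other, even if they have equally many children.
  tag := if p.1.2 then 0 else 1

/-- The right-hand side of a rule, with factors for the literal and the coefficient. -/
def GRule.modelShape (p : ρ.GRule) : Shape ρ.signature V (fun _ => []) [] :=
  p.shape (Option p.Lit) (fun e => e.elim (.inr p.1) fun y => .inl y.1)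
    (fun e => match e with
      | none => fun j => j.elim0
      | some y => fun _ => y)
    (by
      rintro (_ | y) j
      · exact j.elim0
      · obtain rfl : j = ⟨0, Nat.one_pos⟩ := Subsingleton.elim (α := Fin 1) _ _
        rfl)

/-- The right-hand side of a rule, with an indicator of the value `ξ x` of its variable `x`. -/
def GRule.queryShape (ξ : X → Bool) (p : ρ.GRule) : Shape ρ.signature V (fun _ => []) [] :=
  p.shape p.Lit (fun y => .inl (y.1.1, ξ y.1.1)) (fun y _ => y) (by
    intro y j
    obtain rfl : j = ⟨0, Nat.one_pos⟩ := Subsingleton.elim (α := Fin 1) _ _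
    rfl)

variable (ρ)

/-- The grammar of a diagram. -/
noncomputable def grammar (root : V) : FGG ρ.signature :=
  FGG.ofShapes (fun _ : V => []) (fun p : ρ.GRule => p.1.1) GRule.modelShape root rfl

/-- The grammar that fixes the assignment `ξ`. -/
noncomputable def query (root : V) (ξ : X → Bool) : FGG ρ.signature :=
  FGG.ofShapes (fun _ : V => []) (fun p : ρ.GRule => p.1.1) (GRule.queryShape ξ) root rfl

variable {ρ}

theorem shape_size (p : ρ.GRule) :
    Nat.card p.Lit ≤ 1 ∧ (Finset.Ico (if p.1.2 then 0 else 1)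
      ((if p.1.2 then 0 else 1) + Nat.card (Fin p.rule.kids.length))).card ≤ 2 :=
  ⟨Finite.card_le_one_iff_subsingleton.mpr inferInstance, by
    simpa using ρ.kids_le _ _ _ p.rule_eq⟩

theorem grammar_linearSize (root : V) : (ρ.grammar root).LinearSize (Nat.card V) :=
  ⟨ρ.card_rule_le, fun p => ⟨by
    simpa [grammar, FGG.ofShapes, Shape.toRHS, GRule.modelShape, GRule.shape]
      using (shape_size p).1, (shape_size p).2, by
    have : Nat.card (Option p.Lit) ≤ 2 := by
      rw [Finite.card_option]
      exact Nat.succ_le_succ (shape_size p).1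
    exact this⟩⟩

theorem query_linearSize (root : V) (ξ : X → Bool) : (ρ.query root ξ).LinearSize (Nat.card V) :=
  ⟨ρ.card_rule_le, fun p => ⟨by
    simpa [query, FGG.ofShapes, Shape.toRHS, GRule.queryShape, GRule.shape]
      using (shape_size p).1, (shape_size p).2, (shape_size p).1.trans one_le_two⟩⟩

theorem query_isQuery (root : V) (ξ : X → Bool) : (ρ.query root ξ).IsQuery ξ := by
  intro p y
  let y' : p.Lit := y
  refine ⟨y'.1.1, rfl, fun a => ⟨fun h => ?_, fun h => ?_⟩⟩
  · exact if_pos (h ⟨0, Nat.one_pos⟩)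
  · obtain ⟨i, hi⟩ := h
    obtain rfl : i = ⟨0, Nat.one_pos⟩ := Subsingleton.elim (α := Fin 1) _ _
    exact if_neg hi

/-! ### Sum–products -/

/-- If the rules of a grammar correspond to those of a diagram, where `w r` is the sum of the weights
of the assignments to the right-hand side of `r`, then its sum–products satisfy the same recursion. -/
theorem derivationSum_eq_of_rules {K : FGG ρ.signature} (hK : ∀ Y, K.ntype Y = []) (nt : V → K.N)
    (rl : ρ.GRule → K.Rule) (hl : ∀ p, K.lhs (rl p) = nt p.1.1) (hinj : Function.Injective rl)
    (hsurj : ∀ r v, K.lhs r = nt v → ∃ p : ρ.GRule, p.1.1 = v ∧ rl p = r)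
    (w : DiagramRule X V → ℝ≥0∞) (hw : ∀ p, (K.rhs (rl p)).nodeSum = w p.rule)
    (hprod : ∀ (p : ρ.GRule) (f : K.N → ℝ≥0∞),
      ∏ e, f ((K.rhs (rl p)).nlab e) = (p.rule.kids.map fun v => f (nt v)).prod)
    (val : V → ℝ≥0∞)
    (hval : ∀ v, val v = ∑ b, (ρ.rule v b).elim 0 fun r => w r * (r.kids.map val).prod) (v : V) :
    K.derivationSum (nt v) = val v := by
  induction v using ρ.wf.induction with
  | _ v ih =>
    let g : {b // (ρ.rule v b).isSome} → {r // K.lhs r = nt v} :=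
      fun b => ⟨rl ⟨(v, b.1), b.2⟩, hl _⟩
    have hg : Function.Bijective g := by
      constructor
      · rintro ⟨b, hb⟩ ⟨c, hc⟩ h
        have := hinj (Subtype.ext_iff.mp h)
        simpa using this
      · rintro ⟨r, hr⟩
        obtain ⟨⟨⟨v', b⟩, hb⟩, rfl, rfl⟩ := hsurj r v hr
        exact ⟨⟨b, hb⟩, rfl⟩
    rw [K.derivationSum_eq hK, hval, ← (Equiv.ofBijective g hg).tsum_eq]
    refine Eq.trans ?_ (tsum_fintype (L := .unconditional Bool) _)
    have h1 : ∀ b : {b // (ρ.rule v b).isSome},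
        ((K.rhs (Equiv.ofBijective g hg b).1).nodeSum *
          ∏ e, K.derivationSum ((K.rhs (Equiv.ofBijective g hg b).1).nlab e)) =
        (fun b => (ρ.rule v b).elim 0 fun r => w r * (r.kids.map val).prod) b.1 := by
      rintro ⟨b, hb⟩
      let p : ρ.GRule := ⟨(v, b), hb⟩
      change (K.rhs (rl p)).nodeSum * ∏ e, K.derivationSum ((K.rhs (rl p)).nlab e) =
        (ρ.rule p.1.1 p.1.2).elim 0 fun r => w r * (r.kids.map val).prod
      rw [hw, hprod, p.rule_eq]
      simp only [Option.elim_some]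
      congr 2
      refine List.map_congr_left fun u hu => ih u ⟨b, p.rule, p.rule_eq, hu⟩
    refine (tsum_congr h1).trans ?_
    -- A missing rule contributes 0, so the sum extends to both Boolean indices.
    refine tsum_subtype_eq_of_support_subset (s := {b | (ρ.rule v b).isSome})
      (f := fun b => (ρ.rule v b).elim 0 fun r => w r * (r.kids.map val).prod) ?_
    intro b hb
    by_contra h
    simp only [Set.mem_ofPred_eq, Option.not_isSome_iff_eq_none] at h
    simp [h] at hb

theorem prod_edges (p : ρ.GRule) {T : Type} [Finite T] {tlab : T → Term X V}
    {tatt : (e : T) → Fin (type (tlab e)).length → p.Lit} {tatt_lab} (f : V → ℝ≥0∞) :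
    ∏ e, f ((p.shape T tlab tatt tatt_lab).toRHS.nlab e) = (p.rule.kids.map f).prod := by
  let k : (p.shape T tlab tatt tatt_lab).edgeNames ≃ Fin p.rule.kids.length :=
    (p.shape T tlab tatt tatt_lab).edgeEquiv
  refine (k.prod_comp fun i => f (p.rule.kids.get i)).trans ?_
  rw [← List.prod_ofFn]
  congr 1
  conv_rhs => rw [← List.ofFn_get p.rule.kids, List.map_ofFn]
  rfl

theorem model_weight (p : ρ.GRule) (a : p.Lit → Bool) :
    ((∏ᶠ e, ρ.fn (p.modelShape.tlab e) fun i => a (p.modelShape.tatt e i) : ℝ≥0) : ℝ≥0∞) =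
      p.rule.coef * ∏ᶠ y : p.Lit, ((if a y = y.1.2 then 1 else 0 : ℝ≥0) : ℝ≥0∞) := by
  have := Fintype.ofFinite p.Lit
  have h := ENNReal.coe_finprod (ι := Option p.Lit)
    fun e => ρ.fn (p.modelShape.tlab e) fun i => a (p.modelShape.tatt e i)
  refine h.trans ?_
  rw [Fintype.prod_option, finprod_eq_prod_of_fintype]
  refine congrArg₂ (· * ·) ?_ rfl
  change (((ρ.rule p.1.1 p.1.2).elim 0 DiagramRule.coef : ℝ≥0) : ℝ≥0∞) = _
  rw [p.rule_eq]
  rfl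

theorem query_weight (p : ρ.GRule) (ξ : X → Bool) (a : p.Lit → Bool) :
    ((∏ᶠ e, ρ.fn ((p.queryShape ξ).tlab e) fun i => a ((p.queryShape ξ).tatt e i) : ℝ≥0) : ℝ≥0∞) =
      ∏ᶠ y : p.Lit, ((if a y = ξ y.1.1 then 1 else 0 : ℝ≥0) : ℝ≥0∞) := by
  have := Fintype.ofFinite p.Lit
  have h := ENNReal.coe_finprod (ι := p.Lit)
    fun e => ρ.fn ((p.queryShape ξ).tlab e) fun i => a ((p.queryShape ξ).tatt e i)
  refine h.trans ?_
  rw [finprod_eq_prod_of_fintype]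
  rfl

/-- Assignments to the nodes of a rule are assignments to its literal. -/
noncomputable def nodeAssignment (p : ρ.GRule) :
    (Finset.range (Nat.card p.Lit) → Bool) ≃ (p.Lit → Bool) :=
  Equiv.arrowCongr p.modelShape.nodeEquiv (Equiv.refl Bool)

/-- The indicator of the literal holds for exactly one value of its node, so only the coefficient
survives. -/
theorem grammar_nodeSum (root : V) (p : ρ.GRule) :
    ((ρ.grammar root).rhs p).nodeSum = p.rule.coef := by
  have := Fintype.ofFinite p.Lit
  have h : ((ρ.grammar root).rhs p).nodeSum = ∑' a : p.Lit → Bool,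
      ((∏ᶠ e, ρ.fn (p.modelShape.tlab e) fun i => a (p.modelShape.tatt e i) : ℝ≥0) : ℝ≥0∞) := by
    rw [← (nodeAssignment p).tsum_eq]
    exact tsum_congr fun a => rfl
  rw [h, tsum_congr (model_weight p), ENNReal.tsum_mul_left]
  simp only [finprod_eq_prod_of_fintype]
  rw [ENNReal.tsum_pi_prod (fun _ : p.Lit => Bool)
    fun y b => ((if b = y.1.2 then 1 else 0 : ℝ≥0) : ℝ≥0∞)]
  rw [Finset.prod_eq_one, mul_one]
  rintro ⟨⟨x, b⟩, -⟩ -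
  cases b <;> simp [tsum_fintype]

/-- The rule of the conjunction that pairs a rule with itself. -/
def diagRule (root : V) (ξ : X → Bool) (p : ρ.GRule) :
    ((ρ.grammar root).conj (ρ.query root ξ)).Rule :=
  ⟨(p, p), rfl, rfl, fun _ _ _ => rfl, rfl, fun _ _ _ => rfl, fun _ _ _ _ h => absurd h (by
    exact Nat.not_lt_zero _), fun _ h => absurd h (Nat.not_lt_zero _)⟩

/-- The node of a literal now carries two indicators, for the value in the literal and for `ξ x`;
their product sums to 1 if these values coincide and to 0 otherwise. -/
theorem conj_nodeSum (root : V) (ξ : X → Bool) (p : ρ.GRule) :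
    (((ρ.grammar root).conj (ρ.query root ξ)).rhs (diagRule root ξ p)).nodeSum =
      p.rule.coef * p.rule.lit.elim 1 fun y => if ξ y.1 = y.2 then 1 else 0 := by
  have := Fintype.ofFinite p.Lit
  have h : (((ρ.grammar root).conj (ρ.query root ξ)).rhs (diagRule root ξ p)).nodeSum =
      ∑' a : p.Lit → Bool, ((∏ᶠ e : Option p.Lit ⊕ p.Lit, (Sum.elim
        (fun e => ρ.fn (p.modelShape.tlab e) fun i => a (p.modelShape.tatt e i))
        (fun e => ρ.fn ((p.queryShape ξ).tlab e) fun i => a ((p.queryShape ξ).tatt e i)) e) : ℝ≥0) :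
          ℝ≥0∞) := by
    rw [← (nodeAssignment p).tsum_eq]
    refine tsum_congr fun a => ?_
    congr 2
    funext e
    cases e <;> rfl
  have h2 : ∀ a : p.Lit → Bool, ((∏ᶠ e : Option p.Lit ⊕ p.Lit, (Sum.elim
        (fun e => ρ.fn (p.modelShape.tlab e) fun i => a (p.modelShape.tatt e i))
        (fun e => ρ.fn ((p.queryShape ξ).tlab e) fun i => a ((p.queryShape ξ).tatt e i)) e) : ℝ≥0) :
          ℝ≥0∞) = p.rule.coef * ∏ y : p.Lit, (((if a y = y.1.2 then 1 else 0 : ℝ≥0) : ℝ≥0∞) *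
            ((if a y = ξ y.1.1 then 1 else 0 : ℝ≥0) : ℝ≥0∞)) := by
    intro a
    refine (ENNReal.coe_finprod (ι := Option p.Lit ⊕ p.Lit) _).trans ?_
    rw [Fintype.prod_sum_type]
    refine (congrArg₂ (· * ·)
      ((ENNReal.coe_finprod (ι := Option p.Lit) _).symm.trans (model_weight p a))
      ((ENNReal.coe_finprod (ι := p.Lit) _).symm.trans (query_weight p ξ a))).trans ?_
    simp only [finprod_eq_prod_of_fintype, Finset.prod_mul_distrib, mul_assoc]
  rw [h, tsum_congr h2, ENNReal.tsum_mul_left,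
    ENNReal.tsum_pi_prod (fun _ : p.Lit => Bool) fun y b =>
      ((if b = y.1.2 then 1 else 0 : ℝ≥0) : ℝ≥0∞) * ((if b = ξ y.1.1 then 1 else 0 : ℝ≥0) : ℝ≥0∞)]
  congr 1
  have key : ∀ o, p.rule.lit = o → ∏ y : p.Lit, ∑' b : Bool,
      ((if b = y.1.2 then 1 else 0 : ℝ≥0) : ℝ≥0∞) * ((if b = ξ y.1.1 then 1 else 0 : ℝ≥0) : ℝ≥0∞) =
      o.elim 1 fun y => if ξ y.1 = y.2 then 1 else 0 := by
    rintro (_ | ⟨x, b⟩) hl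
    · have : IsEmpty p.Lit := ⟨fun y => by simpa [hl] using y.2⟩
      simp
    · rw [Fintype.prod_subsingleton _ (⟨(x, b), hl⟩ : p.Lit)]
      cases b <;> cases h : ξ x <;> simp [tsum_fintype, h]
  exact key _ rfl

/-- All domains are `Bool`, so the casts in `FactorGraph.weight` reduce away and `sumProduct` is by
definition the derivation sum of the start symbol. -/
theorem grammar_sumProduct (root : V) (val : V → ℝ≥0∞)
    (hval : ∀ v, val v =
      ∑ b, (ρ.rule v b).elim 0 fun r => (r.coef : ℝ≥0∞) * (r.kids.map val).prod) :
    (ρ.grammar root).sumProduct = val root :=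
  derivationSum_eq_of_rules (K := ρ.grammar root) (fun _ => rfl) id id (fun _ => rfl)
    Function.injective_id (fun r v h => ⟨r, h, rfl⟩) (fun r => r.coef) (grammar_nodeSum root)
    (fun p f => prod_edges p f) val hval root

/-- If a node has both rules, the name 0 occurs in the rule `true`, which has a child by `kids_ne`,
but not in the rule `false`, whose names start at 1. -/
theorem eq_of_edgeNames_eq {p p' : ρ.GRule} (h : p.1.1 = p'.1.1)
    (he : p.modelShape.edgeNames = p'.modelShape.edgeNames) : p = p' := by
  have key : ∀ v (h1 : (ρ.rule v true).isSome) (h2 : (ρ.rule v false).isSome),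
      (GRule.modelShape (ρ := ρ) ⟨(v, true), h1⟩).edgeNames ≠
        (GRule.modelShape (ρ := ρ) ⟨(v, false), h2⟩).edgeNames := by
    intro v h1 h2 he
    have hk := ρ.kids_ne _ _ _ (GRule.rule_eq ⟨(v, true), h1⟩) (GRule.rule_eq ⟨(v, false), h2⟩)
    have h0 : 0 ∈ (GRule.modelShape (ρ := ρ) ⟨(v, true), h1⟩).edgeNames := by
      simpa [Shape.edgeNames, GRule.modelShape, GRule.shape, List.length_pos_iff] using hk
    rw [he] at h0
    simp [Shape.edgeNames, GRule.modelShape, GRule.shape] at h0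
  obtain ⟨⟨v, b⟩, hb⟩ := p
  obtain ⟨⟨v', b'⟩, hb'⟩ := p'
  obtain rfl : v = v' := h
  cases b <;> cases b'
  · rfl
  · exact absurd he.symm (key v hb' hb)
  · exact absurd he (key v hb hb')
  · rfl

/-- At a nonterminal `(v, v)` the conjunction has only the diagonal rules, so it satisfies the
recursion of the diagram with each rule weighted by the truth value of its literal. -/
theorem conj_sumProduct (root : V) (ξ : X → Bool) (val : V → ℝ≥0∞)
    (hval : ∀ v, val v = ∑ b, (ρ.rule v b).elim 0 fun r =>
      (r.coef * r.lit.elim 1 fun y => if ξ y.1 = y.2 then 1 else 0 : ℝ≥0∞) *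
        (r.kids.map val).prod) :
    ((ρ.grammar root).conj (ρ.query root ξ)).sumProduct = val root := by
  refine derivationSum_eq_of_rules (K := (ρ.grammar root).conj (ρ.query root ξ)) (fun _ => rfl)
    (fun v => ⟨(v, v), rfl⟩) (diagRule root ξ) (fun _ => rfl)
    (fun p p' h => congrArg (fun r => r.1.1) h) ?_
    (fun r => r.coef * r.lit.elim 1 fun y => if ξ y.1 = y.2 then 1 else 0) (conj_nodeSum root ξ)
    (fun p f => prod_edges p fun v => f ⟨(v, v), rfl⟩) val hval root
  rintro ⟨⟨p, p'⟩, hc⟩ v h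
  have h1 : p.1.1 = v := congrArg (fun Y => Y.1.1) h
  have h2 : p'.1.1 = v := congrArg (fun Y => Y.1.2) h
  obtain rfl := eq_of_edgeNames_eq (h1.trans h2.symm) hc.nedges_eq
  exact ⟨p, h1, rfl⟩

variable (ρ) in
/-- The grammars of a diagram have the sum–products given by the recursive formulas. -/
theorem exists_grammar (root : V) (z : V → ℝ≥0∞) (q : (X → Bool) → V → ℝ≥0∞)
    (hz : ∀ v, z v =
      ∑ b, (ρ.rule v b).elim 0 fun r => (r.coef : ℝ≥0∞) * (r.kids.map z).prod)
    (hq : ∀ ξ v, q ξ v = ∑ b, (ρ.rule v b).elim 0 fun r =>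
      (r.coef * r.lit.elim 1 fun y => if ξ y.1 = y.2 then 1 else 0 : ℝ≥0∞) *
        (r.kids.map (q ξ)).prod) :
    ∃ (T : Type) (_ : Finite T) (type : T → List X)
      (F : (t : T) → (Fin (type t).length → Bool) → ℝ≥0)
      (G : FGG (boolSignature X T type F)),
      G.LinearSize (Nat.card V) ∧ G.sumProduct = z root ∧
      ∀ ξ : X → Bool, ∃ Gξ : FGG (boolSignature X T type F),
        Gξ.LinearSize (Nat.card V) ∧ Gξ.IsQuery ξ ∧ (G.conj Gξ).sumProduct = q ξ root :=
  ⟨Term X V, inferInstance, type, ρ.fn, ρ.grammar root, grammar_linearSize root,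
    grammar_sumProduct root z hz, fun ξ => ⟨ρ.query root ξ, query_linearSize root ξ,
      query_isQuery root ξ, conj_sumProduct root ξ (q ξ) (hq ξ)⟩⟩

end Diagram

/-! ## Case–factor diagrams -/

namespace CFD

variable {X : Type} (D : CFD X)

/-- The rules of a node. -/
noncomputable def nodeRule (n : CFDNode X D.V) (b : Bool) : Option (DiagramRule X D.V) :=
  match n, b with
  -- The literal records which child was chosen. An `empty` node gets no rule, so its sum is 0.
  | .case x v₁ _, true => some ⟨some (x, true), D.expCost x, [v₁]⟩
  | .case x _ v₂, false => some ⟨some (x, false), 1, [v₂]⟩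
  | .factor v₁ v₂, true => some ⟨none, 1, [v₁, v₂]⟩
  | .unit, true => some ⟨none, 1, []⟩
  | _, _ => none

theorem nodeRule_kids {n : CFDNode X D.V} {b : Bool} {r : DiagramRule X D.V}
    (h : D.nodeRule n b = some r) : r.kids.length ≤ 2 ∧ ∀ w ∈ r.kids, w ∈ n.children := by
  cases n <;> cases b <;> simp [nodeRule] at h <;> subst h <;> simp [CFDNode.children]

/-- The diagram whose rules generate a case–factor diagram. -/
noncomputable def diagram : Diagram X D.V where
  rule := fun v => D.nodeRule (D.node v)
  kids_le := fun _ _ _ h => (D.nodeRule_kids h).1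
  kids_ne := fun v r r' h h' => by
    generalize D.node v = n at h h'
    cases n <;> simp [nodeRule] at h h'
    subst h
    simp
  wf := by
    have := D.finite_V
    refine Subrelation.wf ?_ D.dag.wf
    rintro w v ⟨b, r, h, hw⟩
    exact (D.nodeRule_kids h).2 w hw

theorem zNode_rec (v : D.V) : (D.zNode v : ℝ≥0∞) = ∑ b, (D.diagram.rule v b).elim 0 fun r =>
    (r.coef : ℝ≥0∞) * (r.kids.map fun v => (D.zNode v : ℝ≥0∞)).prod := by
  rw [zNode]
  simp only [Fintype.sum_bool, diagram]
  split <;> rename_i h <;> simp [h, nodeRule]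

theorem qNode_rec (ξ : X → Bool) (v : D.V) : (D.qNode ξ v : ℝ≥0∞) =
    ∑ b, (D.diagram.rule v b).elim 0 fun r =>
      (r.coef * r.lit.elim 1 fun y => if ξ y.1 = y.2 then 1 else 0 : ℝ≥0∞) *
        (r.kids.map fun v => (D.qNode ξ v : ℝ≥0∞)).prod := by
  rw [qNode]
  simp only [Fintype.sum_bool, diagram]
  split <;> rename_i h
  · rename_i x v₁ v₂
    cases hx : ξ x <;> simp [h, nodeRule, hx]
  all_goals simp [h, nodeRule]

theorem exists_grammar [Finite X] :
    ∃ (T : Type) (_ : Finite T) (type : T → List X)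
      (F : (t : T) → (Fin (type t).length → Bool) → ℝ≥0)
      (G : FGG (boolSignature X T type F)),
      G.LinearSize (Nat.card D.V) ∧ G.sumProduct = (D.Z : ℝ≥0∞) ∧
      ∀ ξ : X → Bool, ∃ Gξ : FGG (boolSignature X T type F),
        Gξ.LinearSize (Nat.card D.V) ∧ Gξ.IsQuery ξ ∧ (G.conj Gξ).sumProduct = (D.q ξ : ℝ≥0∞) :=
  have := D.finite_V
  D.diagram.exists_grammar D.root (fun v => D.zNode v) (fun ξ v => D.qNode ξ v)
    D.zNode_rec D.qNode_rec

end CFD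

/-! ## Sum–product networks -/

namespace SPN

/-! ### Recursion for the occurrences of literals -/

section Scope

variable {X V : Type} {node : V → SPNNode X V}

theorem mem_spnPos {v : V} {x : X} :
    x ∈ spnPos node v ↔ node v = .pos x ∨ ∃ u ∈ (node v).children, x ∈ spnPos node u := by
  constructor
  · rintro ⟨w, hw, hx⟩
    rcases Relation.ReflTransGen.cases_head hw with rfl | ⟨u, hu, hw⟩
    · exact Or.inl hx
    · exact Or.inr ⟨u, hu, w, hw, hx⟩
  · rintro (h | ⟨u, hu, w, hw, hx⟩)
    · exact ⟨v, .refl, h⟩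
    · exact ⟨w, .head hu hw, hx⟩

theorem mem_spnNeg {v : V} {x : X} :
    x ∈ spnNeg node v ↔ node v = .neg x ∨ ∃ u ∈ (node v).children, x ∈ spnNeg node u := by
  constructor
  · rintro ⟨w, hw, hx⟩
    rcases Relation.ReflTransGen.cases_head hw with rfl | ⟨u, hu, hw⟩
    · exact Or.inl hx
    · exact Or.inr ⟨u, hu, w, hw, hx⟩
  · rintro (h | ⟨u, hu, w, hw, hx⟩)
    · exact ⟨v, .refl, h⟩
    · exact ⟨w, .head hu hw, hx⟩

end Scope

variable {X : Type} (D : SPN X)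

/-- The value of a node when all literals are replaced with one. -/
noncomputable def zNode {X : Type} (D : SPN X) (v : D.V) : ℝ≥0 :=
  match h : D.node v with
  | .sum c₁ c₂ v₁ v₂ => c₁ * D.zNode v₁ + c₂ * D.zNode v₂
  | .product v₁ v₂ => D.zNode v₁ * D.zNode v₂
  | .pos _ => 1
  | .neg _ => 1
termination_by v
decreasing_by all_goals simp [IsChild, h, SPNNode.children]

/-- The rules of a node. -/
noncomputable def nodeRule (n : SPNNode X D.V) (b : Bool) : Option (DiagramRule X D.V) :=
  match n, b with
  | .sum c₁ _ v₁ _, true => some ⟨none, c₁, [v₁]⟩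
  | .sum _ c₂ _ v₂, false => some ⟨none, c₂, [v₂]⟩
  | .product v₁ v₂, true => some ⟨none, 1, [v₁, v₂]⟩
  | .pos x, true => some ⟨some (x, true), 1, []⟩
  | .neg x, true => some ⟨some (x, false), 1, []⟩
  | _, _ => none

theorem nodeRule_kids {n : SPNNode X D.V} {b : Bool} {r : DiagramRule X D.V}
    (h : D.nodeRule n b = some r) : r.kids.length ≤ 2 ∧ ∀ w ∈ r.kids, w ∈ n.children := by
  cases n <;> cases b <;> simp [nodeRule] at h <;> subst h <;> simp [SPNNode.children]

/-- The diagram whose rules generate a sum–product network. -/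
noncomputable def diagram : Diagram X D.V where
  rule := fun v => D.nodeRule (D.node v)
  kids_le := fun _ _ _ h => (D.nodeRule_kids h).1
  kids_ne := fun v r r' h h' => by
    generalize D.node v = n at h h'
    cases n <;> simp [nodeRule] at h h'
    subst h
    simp
  wf := by
    have := D.finite_V
    refine Subrelation.wf ?_ D.dag.wf
    rintro w v ⟨b, r, h, hw⟩
    exact (D.nodeRule_kids h).2 w hw

theorem zNode_rec (v : D.V) : (D.zNode v : ℝ≥0∞) = ∑ b, (D.diagram.rule v b).elim 0 fun r =>
    (r.coef : ℝ≥0∞) * (r.kids.map fun v => (D.zNode v : ℝ≥0∞)).prod := by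
  rw [zNode]
  simp only [Fintype.sum_bool, diagram]
  split <;> rename_i h <;> simp [h, nodeRule]

theorem qNode_rec (ξ : X → Bool) (v : D.V) : (D.qNode ξ v : ℝ≥0∞) =
    ∑ b, (D.diagram.rule v b).elim 0 fun r =>
      (r.coef * r.lit.elim 1 fun y => if ξ y.1 = y.2 then 1 else 0 : ℝ≥0∞) *
        (r.kids.map fun v => (D.qNode ξ v : ℝ≥0∞)).prod := by
  rw [qNode]
  simp only [Fintype.sum_bool, diagram]
  split <;> rename_i h
  · simp [h, nodeRule]
  · simp [h, nodeRule]
  all_goals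
    rename_i x
    cases hx : ξ x <;> simp [h, nodeRule, hx]

open Classical in
/-- The value of a node is a sum of multiples of indicators of assignments to its scope. -/
theorem exists_expansion (v : D.V) :
    ∃ (ι : Type) (_ : Fintype ι) (c : ι → ℝ≥0) (α : ι → X → Bool), D.zNode v = ∑ i, c i ∧
      (∀ ξ, D.qNode ξ v = ∑ i, if ∀ x ∈ spnScope D.node v, α i x = ξ x then c i else 0) ∧
      ∀ i, ∀ x ∈ spnScope D.node v, (α i x = true → x ∈ spnPos D.node v) ∧
        (α i x = false → x ∈ spnNeg D.node v) := by
  have := D.finite_V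
  induction v using D.dag.wf.induction with
  | _ v ih =>
    have hch : ∀ {u}, u ∈ (D.node v).children → IsChild (fun u => (D.node u).children) v u := id
    cases h : D.node v with
    | sum c₁ c₂ v₁ v₂ =>
      obtain ⟨ι₁, _, a₁, α₁, hz₁, hq₁, hs₁⟩ := ih v₁ (hch (by simp [h, SPNNode.children]))
      obtain ⟨ι₂, _, a₂, α₂, hz₂, hq₂, hs₂⟩ := ih v₂ (hch (by simp [h, SPNNode.children]))
      have hpos : ∀ x, x ∈ spnPos D.node v ↔ x ∈ spnPos D.node v₁ ∨ x ∈ spnPos D.node v₂ := by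
        intro x
        simp [mem_spnPos (v := v), h, SPNNode.children]
      have hneg : ∀ x, x ∈ spnNeg D.node v ↔ x ∈ spnNeg D.node v₁ ∨ x ∈ spnNeg D.node v₂ := by
        intro x
        simp [mem_spnNeg (v := v), h, SPNNode.children]
      have h12 := D.sum_scope v c₁ c₂ v₁ v₂ h
      -- Equality of scopes makes the indicators of both children speak about the same variables as
      -- those of `v`.
      have h1 : spnScope D.node v = spnScope D.node v₁ := by
        ext x
        have := Set.ext_iff.mp h12 x
        simp only [spnScope, Set.mem_union, hpos, hneg] at this ⊢
        tauto
      have h2 := h1.trans h12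
      refine ⟨ι₁ ⊕ ι₂, inferInstance, Sum.elim (fun i => c₁ * a₁ i) fun i => c₂ * a₂ i,
        Sum.elim α₁ α₂, ?_, ?_, ?_⟩
      · rw [zNode]
        split <;> rename_i h' <;> rw [h] at h' <;> cases h'
        simp [hz₁, hz₂, Finset.mul_sum]
      · intro ξ
        rw [qNode]
        split <;> rename_i h' <;> rw [h] at h' <;> cases h'
        rw [Fintype.sum_sum_type]
        simp only [Sum.elim_inl, Sum.elim_inr]
        rw [hq₁, hq₂, ← h1, ← h2, Finset.mul_sum, Finset.mul_sum]
        simp only [mul_ite, mul_zero]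
        congr!
      · rintro (i | i) x hx
        · have := hs₁ i x (h1 ▸ hx)
          exact ⟨fun h => (hpos x).mpr (Or.inl (this.1 h)),
            fun h => (hneg x).mpr (Or.inl (this.2 h))⟩
        · have := hs₂ i x (h2 ▸ hx)
          exact ⟨fun h => (hpos x).mpr (Or.inr (this.1 h)),
            fun h => (hneg x).mpr (Or.inr (this.2 h))⟩
    | product v₁ v₂ =>
      obtain ⟨ι₁, _, a₁, α₁, hz₁, hq₁, hs₁⟩ := ih v₁ (hch (by simp [h, SPNNode.children]))
      obtain ⟨ι₂, _, a₂, α₂, hz₂, hq₂, hs₂⟩ := ih v₂ (hch (by simp [h, SPNNode.children]))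
      have hpos : ∀ x, x ∈ spnPos D.node v ↔ x ∈ spnPos D.node v₁ ∨ x ∈ spnPos D.node v₂ := by
        intro x
        simp [mem_spnPos (v := v), h, SPNNode.children]
      have hneg : ∀ x, x ∈ spnNeg D.node v ↔ x ∈ spnNeg D.node v₁ ∨ x ∈ spnNeg D.node v₂ := by
        intro x
        simp [mem_spnNeg (v := v), h, SPNNode.children]
      have hsc : ∀ x, x ∈ spnScope D.node v ↔
          x ∈ spnScope D.node v₁ ∨ x ∈ spnScope D.node v₂ := by
        intro x
        simp only [spnScope, Set.mem_union, hpos, hneg]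
        tauto
      obtain ⟨hd₁, hd₂⟩ := D.product_scope v v₁ v₂ h
      -- The scopes of the two children may overlap. A value of `α₁` or `α₂` is witnessed by a
      -- literal of that sign, so validity forbids opposite values on a common variable.
      have hagree : ∀ i j x, x ∈ spnScope D.node v₁ → x ∈ spnScope D.node v₂ →
          α₁ i x = α₂ j x := by
        intro i j x hx₁ hx₂
        have e₁ := hs₁ i x hx₁
        have e₂ := hs₂ j x hx₂
        cases h₁ : α₁ i x <;> cases h₂ : α₂ j x
        · rfl
        · exact (Set.eq_empty_iff_forall_notMem.mp hd₂ x ⟨e₁.2 h₁, e₂.1 h₂⟩).elim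
        · exact (Set.eq_empty_iff_forall_notMem.mp hd₁ x ⟨e₁.1 h₁, e₂.2 h₂⟩).elim
        · rfl
      -- The product of two indicators is the indicator of the merged assignment; on common
      -- variables it does not matter which of the two is taken.
      refine ⟨ι₁ × ι₂, inferInstance, fun p => a₁ p.1 * a₂ p.2,
        fun p x => if x ∈ spnScope D.node v₁ then α₁ p.1 x else α₂ p.2 x, ?_, ?_, ?_⟩
      · rw [zNode]
        split <;> rename_i h' <;> rw [h] at h' <;> cases h'
        rw [hz₁, hz₂, Finset.sum_mul_sum, Fintype.sum_prod_type]
      · intro ξ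
        rw [qNode]
        split <;> rename_i h' <;> rw [h] at h' <;> cases h'
        rw [hq₁, hq₂, Finset.sum_mul_sum, Fintype.sum_prod_type]
        refine Finset.sum_congr rfl fun i _ => Finset.sum_congr rfl fun j _ => ?_
        have : (∀ x ∈ spnScope D.node v,
            (if x ∈ spnScope D.node v₁ then α₁ i x else α₂ j x) = ξ x) ↔
            (∀ x ∈ spnScope D.node v₁, α₁ i x = ξ x) ∧
              ∀ x ∈ spnScope D.node v₂, α₂ j x = ξ x := by
          constructor
          · intro hx
            refine ⟨fun x h₁ => ?_, fun x h₂ => ?_⟩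
            · simpa [h₁] using hx x ((hsc x).mpr (Or.inl h₁))
            · have := hx x ((hsc x).mpr (Or.inr h₂))
              split_ifs at this with h₁
              · exact (hagree i j x h₁ h₂).symm.trans this
              · exact this
          · rintro ⟨hx₁, hx₂⟩ x hx
            split_ifs with h₁
            · exact hx₁ x h₁
            · exact hx₂ x (((hsc x).mp hx).resolve_left h₁)
        rw [if_congr this rfl rfl, ite_and]
        split_ifs <;> simp
      · rintro ⟨i, j⟩ x hx
        simp only [hpos, hneg]
        split_ifs with h₁
        · exact ⟨fun h => Or.inl ((hs₁ i x h₁).1 h), fun h => Or.inl ((hs₁ i x h₁).2 h)⟩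
        · have h₂ := ((hsc x).mp hx).resolve_left h₁
          exact ⟨fun h => Or.inr ((hs₂ j x h₂).1 h), fun h => Or.inr ((hs₂ j x h₂).2 h)⟩
    | pos y =>
      have hpos : ∀ x, x ∈ spnPos D.node v ↔ x = y := by
        intro x
        simp [mem_spnPos (v := v), h, SPNNode.children, eq_comm]
      have hneg : ∀ x, x ∉ spnNeg D.node v := by
        intro x
        simp [mem_spnNeg (v := v), h, SPNNode.children]
      refine ⟨Unit, inferInstance, fun _ => 1, fun _ _ => true, ?_, ?_, ?_⟩
      · rw [zNode]
        split <;> rename_i h' <;> rw [h] at h' <;> cases h'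
        simp
      · intro ξ
        rw [qNode]
        split <;> rename_i h' <;> rw [h] at h' <;> cases h'
        cases hy : ξ y <;> simp [spnScope, hpos, hneg, hy]
      · rintro _ x (hx | hx)
        · exact ⟨fun _ => hx, nofun⟩
        · exact (hneg x hx).elim
    | neg y =>
      have hneg : ∀ x, x ∈ spnNeg D.node v ↔ x = y := by
        intro x
        simp [mem_spnNeg (v := v), h, SPNNode.children, eq_comm]
      have hpos : ∀ x, x ∉ spnPos D.node v := by
        intro x
        simp [mem_spnPos (v := v), h, SPNNode.children]
      refine ⟨Unit, inferInstance, fun _ => 1, fun _ _ => false, ?_, ?_, ?_⟩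
      · rw [zNode]
        split <;> rename_i h' <;> rw [h] at h' <;> cases h'
        simp
      · intro ξ
        rw [qNode]
        split <;> rename_i h' <;> rw [h] at h' <;> cases h'
        cases hy : ξ y <;> simp [spnScope, hpos, hneg, hy]
      · rintro _ x (hx | hx)
        · exact (hpos x hx).elim
        · exact ⟨nofun, fun _ => hx⟩

/-- The scope of the root contains all variables, so each indicator of the expansion holds for
exactly one `ξ`, and summing over `ξ` leaves the sum of the coefficients. -/
theorem zNode_root [Finite X] : D.zNode D.root = D.Z := by
  classical
  obtain ⟨ι, _, c, α, hz, hq, -⟩ := D.exists_expansion D.root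
  have := Fintype.ofFinite X
  rw [Z, hz, finsum_eq_sum_of_fintype]
  simp only [q, hq, D.scope_root, Set.mem_univ, forall_const, ← funext_iff]
  rw [Finset.sum_comm]
  refine Finset.sum_congr rfl fun i _ => ?_
  rw [Finset.sum_ite_eq Finset.univ (α i), if_pos (Finset.mem_univ _)]

theorem exists_grammar [Finite X] :
    ∃ (T : Type) (_ : Finite T) (type : T → List X)
      (F : (t : T) → (Fin (type t).length → Bool) → ℝ≥0)
      (G : FGG (boolSignature X T type F)),
      G.LinearSize (Nat.card D.V) ∧ G.sumProduct = (D.Z : ℝ≥0∞) ∧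
      ∀ ξ : X → Bool, ∃ Gξ : FGG (boolSignature X T type F),
        Gξ.LinearSize (Nat.card D.V) ∧ Gξ.IsQuery ξ ∧ (G.conj Gξ).sumProduct = (D.q ξ : ℝ≥0∞) := by
  have := D.finite_V
  rw [← D.zNode_root]
  exact D.diagram.exists_grammar D.root (fun v => D.zNode v) (fun ξ v => D.qNode ξ v)
    D.zNode_rec D.qNode_rec

end SPN

/-! ### The four conversions -/

theorem mainTheorem1 :
    (∀ (S : Signature.{u}) (B : Type) [Finite B] (H : PFG S B), H.toPlatedGraph.Succeeds →
      ∃ G : FGG S, ∀ M : B → ℕ, ∃ GM : FGG S,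
        GM.FactorFree ∧ (G.conj GM).GeneratesExactly (H.unroll M)) ∧
    (∀ (S : Signature.{u}) (D : DGM S),
      ∃ G : FGG S, ∀ (n : ℕ) (hn : 2 ≤ n), ∃ Gn : FGG S,
        Gn.FactorFree ∧ (G.conj Gn).GeneratesExactly (D.unroll n hn)) ∧
    (∀ (X : Type) [Finite X] (D : CFD X),
      ∃ (T : Type) (_ : Finite T) (type : T → List X)
        (F : (t : T) → (Fin (type t).length → Bool) → ℝ≥0)
        (G : FGG (boolSignature X T type F)),
        G.LinearSize (Nat.card D.V) ∧ G.sumProduct = (D.Z : ℝ≥0∞) ∧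
        ∀ ξ : X → Bool, ∃ Gξ : FGG (boolSignature X T type F),
          Gξ.LinearSize (Nat.card D.V) ∧ Gξ.IsQuery ξ ∧ (G.conj Gξ).sumProduct = (D.q ξ : ℝ≥0∞)) ∧
    (∀ (X : Type) [Finite X] (D : SPN X),
      ∃ (T : Type) (_ : Finite T) (type : T → List X)
        (F : (t : T) → (Fin (type t).length → Bool) → ℝ≥0)
        (G : FGG (boolSignature X T type F)),
        G.LinearSize (Nat.card D.V) ∧ G.sumProduct = (D.Z : ℝ≥0∞) ∧
        ∀ ξ : X → Bool, ∃ Gξ : FGG (boolSignature X T type F),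
          Gξ.LinearSize (Nat.card D.V) ∧ Gξ.IsQuery ξ ∧ (G.conj Gξ).sumProduct = (D.q ξ : ℝ≥0∞)) := by
  exact ⟨fun _ _ _ H h => H.exists_grammar h, fun _ D => D.exists_grammar,
    fun _ _ D => D.exists_grammar, fun _ _ D => D.exists_grammar⟩
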